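/- Consider $n$ periodic tasks $\tau_1,\dots,\tau_n$ on one processor, indexed by strictly decreasing priority. Task $\tau_i$ has a worst-case execution time $C_i>0$, a period $T_i$, a relative deadline $D_i$ with $C_i\le D_i\le T_i$, a phase $\phi_i\ge 0$, and a number $Q_i$ with $0\le Q_i\le C_i$ (all real). Its jobs $k=1,2,\dots$ are released at $\phi_i+(k-1)T_i$ and have absolute deadlines $\phi_i+(k-1)T_i+D_i$; each (re-)execution of a job needs at most $C_i$ time units. The tasks $\tau_1,\dots,\tau_{n_c}$ are critical. The scheduler is work-conserving fixed-priority: it executes the highest-priority pending job (jobs of the same task in order of release), except that a job that has executed for longer than $C_i-Q_i$ time units is not preempted until it completes. The system may be restarted at arbitrary instants. A restart takes $C_r\ge 0$ time units, during which nothing is executed; all jobs that are released but not completed at that instant lose their progress and are executed again from the start with the same priority; completed jobs are not repeated. Any two restarts are at least $T_r\in(0,\infty]$ time units apart, where $T_r=\infty$ (at most one restart ever occurs) or $T_r>\operatorname{lcm}\{T_k : k\le n_c\}$ (if these periods have no common multiple, only $T_r=\infty$ is allowed). The task set is RBR-feasible under this scheduler if (i) for every such set of restart instants, every job of every critical task completes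 by its deadline, and (ii) if no restart occurs, every job of every task completes by its deadline, for all execution times allowed above; this includes that the scheduler does produce a schedule. Define $$\mathcal{WCWE}(1)=C_1,\qquad \mathcal{WCWE}(i)=C_i+\max\bigl(0,\ \mathcal{WCWE}(i-1)-Q_i\bigr)\quad(i\ge 2),$$ $$\mathcal{O}_i^{npe}=\begin{cases}C_r+\mathcal{WCWE}(i)& i\le n_c,\\ 0& i>n_c,\end{cases}\qquad B_i=\max_{j>i}Q_j\quad(B_n=0).$$ Let $L_i$ be the smallest positive solution of $$L_i=B_i+\sum_{j\le i}\left\lceil \frac{L_i}{T_j}\right\rceil C_j+\mathcal{O}_i^{npe},$$ and $K_i=\lceil L_i/T_i\rceil$. For $1\le k\le K_i$ let $S_{i,k}$ be the smallest nonnegative solution (the fixed point reached by iteration from $0$) of $$S_{i,k}=B_i+(k-1)C_i+C_i-Q_i+\sum_{j<i}\left(\left\lfloor \frac{S_{i,k}}{T_j}\right\rfloor+1\right)C_j+\mathcal{O}_i^{npe},$$ and put $F_{i,k}=S_{i,k}+Q_i$ and $R_i=\max_{1\le k\le K_i}\{F_{i,k}-(k-1)T_i\}$. **Theorem.** If all these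 fixed points exist and $R_i\le D_i$ for every $i=1,\dots,n$, then the task set is RBR-feasible under the fixed-priority scheduler with non-preemptive ending regions. -/

import Mathlib

open MeasureTheory Set

/-- A set of `n` periodic tasks on one processor with restart-based recovery. Tasks are indexed in
order of strictly decreasing priority (a smaller index is a higher priority), and the first `nc`
tasks are the critical ones. A job of task `i` runs non-preemptively once it has executed for
longer than `C i - Q i`. -/
structure TaskSet (n : ℕ) where
  /-- worst-case execution times -/
  C : Fin n → ℝ
  /-- periods -/
  T : Fin n → ℝ
  /-- relative deadlines -/
  D : Fin n → ℝ
  /-- phases (release times of the first jobs) -/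
  φ : Fin n → ℝ
  /-- lengths of the non-preemptive ending regions -/
  Q : Fin n → ℝ
  /-- number of critical tasks -/
  nc : ℕ
  /-- time needed to restart the system -/
  Cr : ℝ
  /-- minimum inter-arrival time of restarts (`⊤`: there is never a second restart) -/
  Tr : EReal
  C_pos : ∀ i, 0 < C i
  C_le_D : ∀ i, C i ≤ D i
  D_le_T : ∀ i, D i ≤ T i
  φ_nonneg : ∀ i, 0 ≤ φ i
  Q_nonneg : ∀ i, 0 ≤ Q i
  Q_le_C : ∀ i, Q i ≤ C i
  nc_le : nc ≤ n
  Cr_nonneg : 0 ≤ Cr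

namespace TaskSet

variable {n : ℕ} (τ : TaskSet n)

/-- Task `i` is critical. -/
def Critical (i : Fin n) : Prop := (i : ℕ) < τ.nc

/-- The minimum inter-arrival time of restarts is larger than the least common multiple of the
periods of the critical tasks. If these periods have no common multiple, then the least common
multiple is infinite and the condition says that there is at most one restart. -/
def RestartsAreRare : Prop :=
  τ.Tr = ⊤ ∨ ∃ H : ℝ, 0 < H ∧ (∀ i, τ.Critical i → ∃ m : ℕ, H = m * τ.T i) ∧ (H : EReal) < τ.Tr

/-! ### The scheduler

A job is a pair `(i, k)`: the job number `k` (counted from `0`) of task `i`. A schedule is a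
function `σ` from time to jobs: `σ t = some J` if the processor executes `J` at time `t`, and
`σ t = none` if it is idle or rebooting. `R` is the set of the instants at which the system is
restarted. -/

/-- Possible sets of restart instants. -/
def Admissible (R : Set ℝ) : Prop :=
  (∀ r ∈ R, 0 ≤ r) ∧ ∀ r ∈ R, ∀ r' ∈ R, r < r' → τ.Tr ≤ ((r' - r : ℝ) : EReal)

/-- `e J ρ` is the execution time that job `J` needs in order to complete, in the attempt that
starts from scratch after `ρ`, where `ρ` is a restart instant or the beginning of time. It is
positive and at most the worst-case execution time. -/
def ValidExec (e : Fin n × ℕ → ℝ → ℝ) : Prop := ∀ J ρ, 0 < e J ρ ∧ e J ρ ≤ τ.C J.1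

/-- Release time of a job. -/
def release (J : Fin n × ℕ) : ℝ := τ.φ J.1 + J.2 * τ.T J.1

/-- Absolute deadline of a job. -/
def deadline (J : Fin n × ℕ) : ℝ := τ.release J + τ.D J.1

/-- Amount of execution that `J` receives in `[ρ, u)`. -/
noncomputable def service (σ : ℝ → Option (Fin n × ℕ)) (J : Fin n × ℕ) (ρ u : ℝ) : ℝ :=
  (volume {s | s ∈ Ico ρ u ∧ σ s = some J}).toReal

/-- `J` is complete at time `t`: at some time `u ≤ t` it had received all the execution it needs
since the beginning `ρ` of an attempt, without a restart strictly between `ρ` and `u`. -/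
def Completed (R : Set ℝ) (e : Fin n × ℕ → ℝ → ℝ) (σ : ℝ → Option (Fin n × ℕ))
    (J : Fin n × ℕ) (t : ℝ) : Prop :=
  ∃ ρ u, (ρ = 0 ∨ ρ ∈ R) ∧ 0 ≤ ρ ∧ ρ ≤ u ∧ u ≤ t ∧ (∀ r ∈ R, ¬ (ρ < r ∧ r < u)) ∧
    e J ρ ≤ service σ J ρ u

/-- `J` is released and not complete at time `t`. -/
def Pending (R : Set ℝ) (e : Fin n × ℕ → ℝ → ℝ) (σ : ℝ → Option (Fin n × ℕ))
    (J : Fin n × ℕ) (t : ℝ) : Prop :=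
  τ.release J ≤ t ∧ ¬ Completed R e σ J t

/-- `ρ` is the last restart instant up to and including `t`, or `0` if there is none. -/
def LastStart (R : Set ℝ) (ρ t : ℝ) : Prop :=
  (ρ = 0 ∨ ρ ∈ R) ∧ ρ ≤ t ∧ ∀ r ∈ R, r ≤ t → r ≤ ρ

/-- `J` is in its non-preemptive ending region at time `t`: it is pending and has executed for
longer than `C - Q` since the last restart. -/
def NonPreemptive (R : Set ℝ) (e : Fin n × ℕ → ℝ → ℝ) (σ : ℝ → Option (Fin n × ℕ))
    (J : Fin n × ℕ) (t : ℝ) : Prop :=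
  τ.Pending R e σ J t ∧ ∃ ρ, LastStart R ρ t ∧ τ.C J.1 - τ.Q J.1 < service σ J ρ t

/-- The scheduler may execute `J` at time `t`: `J` is the earliest pending job of its task, and
either `J` is in its non-preemptive region, or no job is in its non-preemptive region and no
pending job has a higher priority. -/
def Eligible (R : Set ℝ) (e : Fin n × ℕ → ℝ → ℝ) (σ : ℝ → Option (Fin n × ℕ))
    (J : Fin n × ℕ) (t : ℝ) : Prop :=
  τ.Pending R e σ J t ∧ (∀ k < J.2, ¬ τ.Pending R e σ (J.1, k) t) ∧
    (τ.NonPreemptive R e σ J t ∨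
      (∀ J', ¬ τ.NonPreemptive R e σ J' t) ∧ ∀ J', τ.Pending R e σ J' t → J.1 ≤ J'.1)

/-- The system is being restarted at time `t`. -/
def Rebooting (R : Set ℝ) (t : ℝ) : Prop := ∃ r ∈ R, r ≤ t ∧ t < r + τ.Cr

/-- `σ` is a schedule produced by the work-conserving fixed-priority scheduler with non-preemptive
ending regions when the system is restarted exactly at the instants in `R`. Each scheduling
decision is kept for a positive amount of time. -/
structure IsFPSchedule (R : Set ℝ) (e : Fin n × ℕ → ℝ → ℝ) (σ : ℝ → Option (Fin n × ℕ)) :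
    Prop where
  measurable : ∀ J, MeasurableSet {t | σ t = some J}
  right_constant : ∀ t, 0 ≤ t → ∃ ε > 0, ∀ s ∈ Ico t (t + ε), σ s = σ t
  rebooting : ∀ t, 0 ≤ t → τ.Rebooting R t → σ t = none
  work_conserving : ∀ t, 0 ≤ t → ¬ τ.Rebooting R t → (∃ J, τ.Pending R e σ J t) → σ t ≠ none
  eligible : ∀ t, 0 ≤ t → ∀ J, σ t = some J → τ.Eligible R e σ J t

/-- With restarts at `R` and execution times `e`, the scheduler does produce a schedule, and in
each schedule that it may produce every job of every task in `P` completes by its deadline. -/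
def MeetsDeadlines (R : Set ℝ) (e : Fin n × ℕ → ℝ → ℝ) (P : Fin n → Prop) : Prop :=
  (∃ σ, τ.IsFPSchedule R e σ) ∧
    ∀ σ, τ.IsFPSchedule R e σ → ∀ i, P i → ∀ k, Completed R e σ (i, k) (τ.deadline (i, k))

/-- Feasibility under restart-based recovery with the fixed-priority scheduler with non-preemptive
ending regions: critical tasks meet all their deadlines whenever restarts occur, and all tasks meet
all their deadlines if no restart occurs. -/
def RBRFeasible : Prop :=
  (∀ R e, τ.Admissible R → τ.ValidExec e → τ.MeetsDeadlines R e τ.Critical) ∧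
    ∀ e, τ.ValidExec e → τ.MeetsDeadlines ∅ e (fun _ => True)

/-! ### The response-time analysis -/

/-- Blocking from lower-priority tasks (`0` for the task with the lowest priority). -/
noncomputable def B (i : Fin n) : ℝ :=
  if h : (Finset.Ioi i).Nonempty then (Finset.Ioi i).sup' h τ.Q else 0

/-- Worst-case wasted execution; the argument `m` stands for the task with index `m`, so that the
highest-priority task has `m = 0`. -/
noncomputable def wcweAux : (m : ℕ) → m < n → ℝ
  | 0, h => τ.C ⟨0, h⟩
  | m + 1, h =>
      τ.C ⟨m + 1, h⟩ + max 0 (wcweAux m (Nat.lt_of_succ_lt h) - τ.Q ⟨m + 1, h⟩)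

/-- Worst-case wasted execution of task `i`. -/
noncomputable def WCWE (i : Fin n) : ℝ := τ.wcweAux i i.isLt

open Classical in
/-- Maximum overhead of a restart on the response time of task `i`. -/
noncomputable def overhead (i : Fin n) : ℝ := if τ.Critical i then τ.Cr + τ.WCWE i else 0

/-- `L` is the length of the longest level-`i` active period: the smallest positive fixed point. -/
def IsActivePeriod (i : Fin n) (L : ℝ) : Prop :=
  IsLeast {L : ℝ | 0 < L ∧
    L = τ.B i + ∑ j ∈ Finset.Iic i, (⌈L / τ.T j⌉ : ℝ) * τ.C j + τ.overhead i} L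

/-- `S` is the worst-case start time of the non-preemptive region of the `k`-th job (`k ≥ 1`) of
task `i`: the smallest nonnegative fixed point, to which the iteration from `0` converges. -/
def IsStartTime (i : Fin n) (k : ℕ) (S : ℝ) : Prop :=
  IsLeast {S : ℝ | 0 ≤ S ∧
    S = τ.B i + ((k : ℝ) - 1) * τ.C i + τ.C i - τ.Q i
      + ∑ j ∈ Finset.Iio i, ((⌊S / τ.T j⌋ : ℝ) + 1) * τ.C j + τ.overhead i} S

/-- `F` is the worst-case finish time of the `k`-th job (`k ≥ 1`) of task `i`. -/
def IsFinishTime (i : Fin n) (k : ℕ) (F : ℝ) : Prop :=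
  ∃ S, τ.IsStartTime i k S ∧ F = S + τ.Q i

/-- `r` is the worst-case response time of task `i` as computed by the analysis: all the fixed
points involved exist, and `r` is the maximum of `F k - (k - 1) * T` over `1 ≤ k ≤ ⌈L / T⌉`. -/
def IsResponseTime (i : Fin n) (r : ℝ) : Prop :=
  ∃ (L : ℝ) (F : ℕ → ℝ), τ.IsActivePeriod i L ∧
    (∀ k ∈ Icc 1 ⌈L / τ.T i⌉₊, τ.IsFinishTime i k (F k)) ∧
    IsGreatest ((fun k : ℕ => F k - ((k : ℝ) - 1) * τ.T i) '' Icc 1 ⌈L / τ.T i⌉₊) r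

end TaskSet

namespace TaskSet

variable {n : ℕ} (τ : TaskSet n)

/-! ### The response-time analysis -/

/-! Suppose that a job of task `i` is incomplete at its deadline. Let `a` be the last instant up to
its release at which every earlier released job of the tasks `j ≤ i` is complete and no reboot is
going on (`exists_busyWindow`). From `a` on the processor has four uses: a lower-priority job that
entered its ending region by `a` can run only in the first `B i` time units (`BusyWindow.sub_le_B`);
a reboot takes at most `Cr`; a restart destroys at most `WCWE i` of execution (`sum_wasted_le`); the
rest serves jobs of the tasks `j ≤ i` released since `a`. If the window contains at most one
restart, adding this up bounds its length (`BusyWindow.exists_demand`).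

This bound is used twice. At length `Λ` it shows that the late job was released less than `Λ` after
`a`, so the analysis covers it. At length `S` it shows that the job reaches its ending region by
about `a + S`; from there nothing interrupts it, and it completes by `a + S + Q`, which is not after
the deadline (`completed_deadline`).

The delicate point is the single restart: the active period `L` may be longer than the distance
between restarts. However, if `H` is a common multiple of the periods of the tasks `j ≤ i`, the job
of task `i` whose period ends at `H` is due by `H`, and the higher-priority work left after its
start time also fits before `H`. Hence the demand in a window of length `H` is at most `H`, and `L`
can be replaced by `min L H` (`exists_analysisBound_le`, by the induction over priorities in
`blocking_add_demand_le`).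

Feasibility also requires that a schedule exists. Every decision depends only on the past and can be
kept for a positive time, so partial schedules extend, and Zorn's lemma gives a schedule for all
times (`exists_isFPSchedule`). -/

theorem T_pos (i : Fin n) : 0 < τ.T i := (τ.C_pos i).trans_le ((τ.C_le_D i).trans (τ.D_le_T i))

theorem Q_le_B {i j : Fin n} (h : i < j) : τ.Q j ≤ τ.B i := by
  have hj : j ∈ Finset.Ioi i := Finset.mem_Ioi.2 h
  rw [B, dif_pos ⟨j, hj⟩]
  exact Finset.le_sup' τ.Q hj

theorem B_nonneg (i : Fin n) : 0 ≤ τ.B i := by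
  rw [B]
  split_ifs with h
  · obtain ⟨j, hj⟩ := h
    exact (τ.Q_nonneg j).trans (Finset.le_sup' τ.Q hj)
  · exact le_rfl

theorem C_le_wcweAux : ∀ (m : ℕ) (h : m < n), τ.C ⟨m, h⟩ ≤ τ.wcweAux m h
  | 0, _ => by rw [wcweAux]
  | m + 1, _ => by
      rw [wcweAux]
      linarith [le_max_left (0 : ℝ) (τ.wcweAux m (Nat.lt_of_succ_lt ‹_›) - τ.Q ⟨m + 1, ‹_›⟩)]

theorem C_le_WCWE (i : Fin n) : τ.C i ≤ τ.WCWE i := τ.C_le_wcweAux i i.isLt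

theorem overhead_nonneg (i : Fin n) : 0 ≤ τ.overhead i := by
  rw [overhead]
  split_ifs
  · linarith [τ.Cr_nonneg, τ.C_le_WCWE i, τ.C_pos i]
  · exact le_rfl

theorem overhead_of_critical {i : Fin n} (h : τ.Critical i) :
    τ.overhead i = τ.Cr + τ.WCWE i := by rw [overhead, if_pos h]

/-- Processor demand in a level-`i` active period of length `x`. -/
noncomputable def busyDemand (i : Fin n) (x : ℝ) : ℝ :=
  τ.B i + ∑ j ∈ Finset.Iic i, (⌈x / τ.T j⌉ : ℝ) * τ.C j + τ.overhead i

/-- Processor demand up to the time `x` at which the non-preemptive region of the `k`-th job of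
task `i` may start. -/
noncomputable def startDemand (i : Fin n) (k : ℕ) (x : ℝ) : ℝ :=
  τ.B i + ((k : ℝ) - 1) * τ.C i + τ.C i - τ.Q i
      + ∑ j ∈ Finset.Iio i, ((⌊x / τ.T j⌋ : ℝ) + 1) * τ.C j + τ.overhead i

/-- `Λ` bounds the length of the level-`i` active periods, and each job that can occur in such a
period finishes in time according to the analysis. -/
def AnalysisBound (i : Fin n) (Λ : ℝ) : Prop :=
  0 < Λ ∧ τ.busyDemand i Λ ≤ Λ ∧ ∀ k : ℕ, 1 ≤ k → ((k : ℝ) - 1) * τ.T i < Λ →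
    ∃ S, 0 ≤ S ∧ S = τ.startDemand i k S ∧ S + τ.Q i ≤ ((k : ℝ) - 1) * τ.T i + τ.D i

/-- The range `1 ≤ k ≤ ⌈L / T⌉` becomes `(k - 1) * T < L`, a condition that only gets stronger when
`L` is replaced by a smaller length. -/
theorem IsResponseTime.exists_analysisBound {i : Fin n} {r : ℝ} (h : τ.IsResponseTime i r)
    (hr : r ≤ τ.D i) : ∃ L, τ.AnalysisBound i L := by
  obtain ⟨L, F, ⟨⟨hL0, hL⟩, -⟩, hF, hg⟩ := h
  refine ⟨L, hL0, hL.symm.le, fun k hk1 hk => ?_⟩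
  have hk' : k ≤ ⌈L / τ.T i⌉₊ := by
    have h1 : ((k - 1 : ℕ) : ℝ) < L / τ.T i := by
      rw [lt_div_iff₀ (τ.T_pos i)]
      push_cast [Nat.cast_sub hk1]
      exact hk
    have := Nat.lt_ceil.2 h1
    omega
  obtain ⟨S, ⟨⟨hS0, hS⟩, -⟩, hFS⟩ := hF k ⟨hk1, hk'⟩
  refine ⟨S, hS0, hS, ?_⟩
  have := hg.2 ⟨k, ⟨hk1, hk'⟩, rfl⟩
  simp only at this
  linarith

theorem sum_filter_succ {M : Type*} [AddCommMonoid M] (g : Fin n → M) (m : Fin n) :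
    ∑ j ∈ Finset.univ.filter (fun j : Fin n => (j : ℕ) < m + 1), g j =
      ∑ j ∈ Finset.univ.filter (fun j : Fin n => (j : ℕ) < m), g j + g m := by
  have : Finset.univ.filter (fun j : Fin n => (j : ℕ) < m + 1) =
      insert m (Finset.univ.filter (fun j : Fin n => (j : ℕ) < m)) := by
    ext j
    simp only [Finset.mem_filter, Finset.mem_univ, true_and, Finset.mem_insert, Fin.ext_iff]
    omega
  rw [this, Finset.sum_insert (by simp), add_comm]

theorem Iio_eq_filter (i : Fin n) :
    Finset.Iio i = Finset.univ.filter (fun j : Fin n => (j : ℕ) < i) := by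
  ext j
  rw [Finset.mem_Iio, Fin.lt_def]
  simp only [Finset.mem_filter, Finset.mem_univ, true_and]

theorem Iic_eq_filter (i : Fin n) :
    Finset.Iic i = Finset.univ.filter (fun j : Fin n => (j : ℕ) < i + 1) := by
  ext j
  rw [Finset.mem_Iic, Fin.le_def]
  simp only [Finset.mem_filter, Finset.mem_univ, true_and, Nat.lt_succ_iff]

theorem sum_Iic (g : Fin n → ℝ) (i : Fin n) :
    ∑ j ∈ Finset.Iic i, g j = ∑ j ∈ Finset.Iio i, g j + g i := by
  rw [Iio_eq_filter, Iic_eq_filter, sum_filter_succ]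

theorem ceil_le_floor_add_ceil (a b : ℝ) : ((⌈a + b⌉ : ℤ) : ℝ) ≤ (⌊a⌋ : ℝ) + 1 + ⌈b⌉ := by
  have : ⌈a + b⌉ ≤ ⌊a⌋ + 1 + ⌈b⌉ := by
    rw [Int.ceil_le]
    push_cast
    linarith [Int.lt_floor_add_one a, Int.le_ceil b]
  exact_mod_cast this

/-- A blocking time `q`, followed by the jobs that higher-priority tasks release strictly inside of
an interval of length `x ≥ q`, fits into the interval. -/
theorem blocking_add_demand_le (h : ∀ i, ∃ L, τ.AnalysisBound i L) (m : ℕ) (hm : m ≤ n) :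
    ∀ q x : ℝ, 0 ≤ q → q ≤ x → (∀ j : Fin n, (j : ℕ) < m → q ≤ τ.B j) →
      q + ∑ j ∈ Finset.univ.filter (fun j : Fin n => (j : ℕ) < m),
        ((⌈x / τ.T j⌉ : ℝ) - 1) * τ.C j ≤ x := by
  induction m with
  | zero => intro q x _ hx _; simpa using hx
  | succ m ih =>
    intro q x hq hx hB
    set i : Fin n := ⟨m, hm⟩ with hi
    have hT := τ.T_pos i
    have hC := τ.C_pos i
    have key := sum_filter_succ (fun j => ((⌈x / τ.T j⌉ : ℝ) - 1) * τ.C j) i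
    simp only [hi] at key
    rw [key, ← hi]
    rcases le_or_gt x (τ.T i) with hxT | hxT
    · have h1 : ⌈x / τ.T i⌉ ≤ 1 := by
        rw [Int.ceil_le]; push_cast; exact (div_le_one hT).2 hxT
      have h2 : ((⌈x / τ.T i⌉ : ℝ) - 1) ≤ 0 := by
        have : ((⌈x / τ.T i⌉ : ℤ) : ℝ) ≤ 1 := by exact_mod_cast h1
        linarith
      have h3 := ih (by omega) q x hq hx (fun j hj => hB j (by omega))
      nlinarith
    · obtain ⟨L, hL0, hL, hS⟩ := h i
      have hqB : q ≤ τ.B i := hB i (by simp [hi])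
      have hO := τ.overhead_nonneg i
      obtain ⟨k, hk⟩ : ∃ k : ℕ, ⌈x / τ.T i⌉ = k + 1 := by
        have : 1 < ⌈x / τ.T i⌉ := by
          rw [Int.lt_ceil]; push_cast; exact (one_lt_div hT).2 hxT
        exact ⟨(⌈x / τ.T i⌉ - 1).toNat, by omega⟩
      have hkx : (k : ℝ) * τ.T i < x := by
        rw [← lt_div_iff₀ hT]
        have : (k : ℤ) < ⌈x / τ.T i⌉ := by omega
        have := Int.lt_ceil.1 this
        exact_mod_cast this
      have hk1 : 1 ≤ k := by
        have : 1 < ⌈x / τ.T i⌉ := by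
          rw [Int.lt_ceil]; push_cast; exact (one_lt_div hT).2 hxT
        omega
      -- If the analysis covers job `k`, then it finishes by `k * T < x`. The equation for `S` pays
      -- for `B i`, for `k * C - Q` and for the higher-priority releases in `[0, S]`; what remains
      -- is the same claim for `x - S` with blocking time `Q i`.
      rcases lt_or_ge (((k : ℝ) - 1) * τ.T i) L with hkL | hkL
      · obtain ⟨S, hS0, hSS, hSD⟩ := hS k hk1 hkL
        have hQx : τ.Q i ≤ x - S := by nlinarith [τ.D_le_T i]
        have h3 := ih (by omega) (τ.Q i) (x - S) (τ.Q_nonneg i) hQx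
          (fun j hj => τ.Q_le_B (Fin.lt_def.2 (by simpa [hi] using hj)))
        rw [startDemand, Iio_eq_filter] at hSS
        have h4 : ∑ j ∈ Finset.univ.filter (fun j : Fin n => (j : ℕ) < m),
              ((⌈x / τ.T j⌉ : ℝ) - 1) * τ.C j ≤
            ∑ j ∈ Finset.univ.filter (fun j : Fin n => (j : ℕ) < m),
              ((⌊S / τ.T j⌋ : ℝ) + 1) * τ.C j +
            ∑ j ∈ Finset.univ.filter (fun j : Fin n => (j : ℕ) < m),
              ((⌈(x - S) / τ.T j⌉ : ℝ) - 1) * τ.C j := by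
          rw [← Finset.sum_add_distrib]
          refine Finset.sum_le_sum fun j _ => ?_
          rw [← add_mul]
          refine mul_le_mul_of_nonneg_right ?_ (τ.C_pos j).le
          have := ceil_le_floor_add_ceil (S / τ.T j) ((x - S) / τ.T j)
          rw [← add_div, add_sub_cancel] at this
          linarith
        have h5 : ((⌈x / τ.T i⌉ : ℝ) - 1) = k := by rw [hk]; push_cast; ring
        rw [h5]
        simp only [hi] at hSS h3 h4 hqB hO hC ⊢
        linarith
      -- Past `L` the utilization takes over: `L` covers its own demand, so the utilization is at
      -- most `1` and the demand grows no faster than `x - L`.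
      · have hxL : 0 < x - L := by linarith
        have hU : ∀ j, L / τ.T j * τ.C j ≤ (⌈L / τ.T j⌉ : ℝ) * τ.C j := fun j =>
          mul_le_mul_of_nonneg_right (Int.le_ceil _) (τ.C_pos j).le
        rw [busyDemand, Iic_eq_filter, sum_filter_succ] at hL
        rw [← sum_filter_succ (fun j => ((⌈x / τ.T j⌉ : ℝ) - 1) * τ.C j) i]
        rw [← sum_filter_succ (fun j => ((⌈L / τ.T j⌉ : ℝ)) * τ.C j) i] at hL
        set s := Finset.univ.filter (fun j : Fin n => (j : ℕ) < i + 1)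
        have hU1 : ∑ j ∈ s, τ.C j / τ.T j ≤ 1 := by
          have h1 : L * ∑ j ∈ s, τ.C j / τ.T j ≤ L * 1 := by
            rw [Finset.mul_sum, mul_one]
            refine le_trans (Finset.sum_le_sum fun j _ => ?_)
              (by linarith [τ.B_nonneg i] : ∑ j ∈ s, (⌈L / τ.T j⌉ : ℝ) * τ.C j ≤ L)
            refine le_trans (le_of_eq ?_) (hU j)
            ring
          exact le_of_mul_le_mul_left h1 hL0
        have h4 : ∑ j ∈ s, ((⌈x / τ.T j⌉ : ℝ) - 1) * τ.C j ≤
            ∑ j ∈ s, (⌈L / τ.T j⌉ : ℝ) * τ.C j + (x - L) * ∑ j ∈ s, τ.C j / τ.T j := by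
          rw [Finset.mul_sum, ← Finset.sum_add_distrib]
          refine Finset.sum_le_sum fun j _ => ?_
          have h6 : (x - L) * (τ.C j / τ.T j) = ((x - L) / τ.T j) * τ.C j := by ring
          rw [h6, ← add_mul]
          refine mul_le_mul_of_nonneg_right ?_ (τ.C_pos j).le
          have h7 := Int.le_ceil (L / τ.T j)
          have h8 := Int.ceil_lt_add_one (x / τ.T j)
          have h9 : x / τ.T j = L / τ.T j + (x - L) / τ.T j := by rw [← add_div]; ring
          linarith
        nlinarith

/-- If the restarts are further apart than a common multiple `H` of the periods, then the analysis
only needs to consider active periods of length at most `H`. -/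
theorem exists_analysisBound_le (h : ∀ i, ∃ L, τ.AnalysisBound i L) (i : Fin n) {H : ℝ}
    (hH : 0 < H) (hm : ∀ j ≤ i, ∃ m : ℕ, H = m * τ.T j) :
    ∃ Λ ≤ H, τ.AnalysisBound i Λ := by
  obtain ⟨L, hL0, hL, hS⟩ := h i
  rcases le_or_gt L H with hLH | hLH
  · exact ⟨L, hLH, hL0, hL, hS⟩
  refine ⟨H, le_rfl, hH, ?_, fun k hk1 hk => hS k hk1 (hk.trans hLH)⟩
  obtain ⟨k, hk⟩ := hm i le_rfl
  have hT := τ.T_pos i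
  have hk1 : 1 ≤ k := by
    rcases Nat.eq_zero_or_pos k with rfl | h0
    · simp at hk; linarith
    · exact h0
  -- The period of this job ends exactly at `H = k * T`, so the job finishes by `H`.
  obtain ⟨S, hS0, hSS, hSD⟩ := hS k hk1 (by nlinarith)
  have hQ : τ.Q i ≤ H - S := by nlinarith [τ.D_le_T i]
  have h3 := τ.blocking_add_demand_le h i i.isLt.le (τ.Q i) (H - S) (τ.Q_nonneg i) hQ
    (fun j hj => τ.Q_le_B (Fin.lt_def.2 hj))
  rw [← Iio_eq_filter] at h3
  rw [startDemand] at hSS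
  rw [busyDemand, sum_Iic]
  have h4 : ∑ j ∈ Finset.Iio i, (⌈H / τ.T j⌉ : ℝ) * τ.C j ≤
      ∑ j ∈ Finset.Iio i, ((⌊S / τ.T j⌋ : ℝ) + 1) * τ.C j +
        ∑ j ∈ Finset.Iio i, ((⌈(H - S) / τ.T j⌉ : ℝ) - 1) * τ.C j := by
    rw [← Finset.sum_add_distrib]
    refine Finset.sum_le_sum fun j hj => ?_
    rw [← add_mul]
    refine mul_le_mul_of_nonneg_right ?_ (τ.C_pos j).le
    obtain ⟨p, hp⟩ := hm j (Finset.mem_Iio.1 hj).le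
    have hpT : H / τ.T j = (p : ℤ) := by
      rw [hp, mul_div_cancel_right₀ _ (τ.T_pos j).ne']; simp
    rw [hpT, Int.ceil_intCast]
    have h9 : ((p : ℤ) : ℝ) = S / τ.T j + (H - S) / τ.T j := by rw [← hpT, ← add_div]; ring
    have h10 : ((p : ℤ) : ℝ) < (⌊S / τ.T j⌋ + 1 + ⌈(H - S) / τ.T j⌉ : ℤ) := by
      push_cast
      rw [← Int.cast_natCast, h9]
      linarith [Int.lt_floor_add_one (S / τ.T j), Int.le_ceil ((H - S) / τ.T j)]
    -- Because `H / T j` is an integer, the strict inequality saves one job compared with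
    -- `ceil_le_floor_add_ceil`; this saving matches the `- 1` in `blocking_add_demand_le`.
    have h11 : (p : ℤ) ≤ ⌊S / τ.T j⌋ + ⌈(H - S) / τ.T j⌉ := by
      have := Int.cast_lt.1 h10
      omega
    have h12 : ((p : ℤ) : ℝ) ≤ (⌊S / τ.T j⌋ : ℝ) + ⌈(H - S) / τ.T j⌉ := by exact_mod_cast h11
    linarith
  have hkT : ⌈H / τ.T i⌉ = k := by
    rw [hk, mul_div_cancel_right₀ _ hT.ne']; simp
  rw [hkT]
  push_cast
  linarith

end TaskSet

namespace TaskSet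

variable {n : ℕ} (τ : TaskSet n)

/-! ### Received service -/

section Service

variable {σ : ℝ → Option (Fin n × ℕ)} {J : Fin n × ℕ} {ρ u v : ℝ}

theorem service_nonneg : 0 ≤ service σ J ρ u := ENNReal.toReal_nonneg

theorem volume_service_ne_top : volume {s | s ∈ Ico ρ u ∧ σ s = some J} ≠ ⊤ :=
  ne_top_of_le_ne_top (by simp [Real.volume_Ico])
    (measure_mono (fun _ h => h.1 : {s | s ∈ Ico ρ u ∧ σ s = some J} ⊆ Ico ρ u))

theorem ofReal_service :
    ENNReal.ofReal (service σ J ρ u) = volume {s | s ∈ Ico ρ u ∧ σ s = some J} :=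
  ENNReal.ofReal_toReal volume_service_ne_top

theorem service_le_sub (h : ρ ≤ u) : service σ J ρ u ≤ u - ρ := by
  have h1 : volume {s | s ∈ Ico ρ u ∧ σ s = some J} ≤ ENNReal.ofReal (u - ρ) := by
    rw [← Real.volume_Ico]
    exact measure_mono fun _ h => h.1
  rw [service]
  exact ENNReal.toReal_le_of_le_ofReal (by linarith) h1

theorem service_self : service σ J ρ ρ = 0 :=
  le_antisymm (by simpa using service_le_sub (σ := σ) (J := J) (le_refl ρ)) service_nonneg

theorem service_eq_sub (h : ρ ≤ u) (hJ : ∀ s ∈ Ico ρ u, σ s = some J) :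
    service σ J ρ u = u - ρ := by
  have : {s | s ∈ Ico ρ u ∧ σ s = some J} = Ico ρ u := by
    ext s; exact ⟨fun h => h.1, fun h => ⟨h, hJ s h⟩⟩
  rw [service, this, Real.volume_Ico, ENNReal.toReal_ofReal (by linarith)]

theorem service_eq_zero (hJ : ∀ s ∈ Ico ρ u, σ s ≠ some J) : service σ J ρ u = 0 := by
  have : {s | s ∈ Ico ρ u ∧ σ s = some J} = ∅ := by
    ext s; simpa using fun h1 h2 => hJ s ⟨h1, h2⟩
  rw [service, this]; simp

theorem exists_of_service_pos (h : 0 < service σ J ρ u) : ∃ s ∈ Ico ρ u, σ s = some J := by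
  by_contra! hc
  rw [service_eq_zero hc] at h
  exact lt_irrefl _ h

theorem service_add (hm : MeasurableSet {t | σ t = some J}) (h1 : ρ ≤ u) (h2 : u ≤ v) :
    service σ J ρ v = service σ J ρ u + service σ J u v := by
  have : {s | s ∈ Ico ρ v ∧ σ s = some J} =
      {s | s ∈ Ico ρ u ∧ σ s = some J} ∪ {s | s ∈ Ico u v ∧ σ s = some J} := by
    ext s
    constructor
    · rintro ⟨⟨h3, h4⟩, h5⟩
      rcases lt_or_ge s u with h | h
      · exact Or.inl ⟨⟨h3, h⟩, h5⟩
      · exact Or.inr ⟨⟨h, h4⟩, h5⟩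
    · rintro (⟨⟨h3, h4⟩, h5⟩ | ⟨⟨h3, h4⟩, h5⟩)
      · exact ⟨⟨h3, h4.trans_le h2⟩, h5⟩
      · exact ⟨⟨h1.trans h3, h4⟩, h5⟩
  have hm' : MeasurableSet {s | s ∈ Ico u v ∧ σ s = some J} := measurableSet_Ico.inter hm
  rw [service, this, measure_union _ hm',
    ENNReal.toReal_add volume_service_ne_top volume_service_ne_top]
  · rfl
  · rw [Set.disjoint_left]
    rintro s ⟨⟨_, h4⟩, _⟩ ⟨⟨h3, _⟩, _⟩
    exact absurd h3 (not_le.2 h4)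

theorem service_mono (hm : MeasurableSet {t | σ t = some J}) (h1 : ρ ≤ u) (h2 : u ≤ v) :
    service σ J ρ u ≤ service σ J ρ v := by
  linarith [service_add hm h1 h2, service_nonneg (σ := σ) (J := J) (ρ := u) (u := v)]

theorem service_mono_left (hm : MeasurableSet {t | σ t = some J}) (h1 : ρ ≤ u) (h2 : u ≤ v) :
    service σ J u v ≤ service σ J ρ v := by
  linarith [service_add hm h1 h2, service_nonneg (σ := σ) (J := J) (ρ := ρ) (u := u)]

theorem service_le_add (hm : MeasurableSet {t | σ t = some J}) (h1 : ρ ≤ u) (h2 : u ≤ v) :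
    service σ J ρ v ≤ service σ J ρ u + (v - u) := by
  linarith [service_add hm h1 h2, service_le_sub (σ := σ) (J := J) h2]

theorem continuousOn_service (hm : MeasurableSet {t | σ t = some J}) :
    ContinuousOn (service σ J ρ) (Ici ρ) := by
  refine LipschitzOnWith.continuousOn (K := 1) (LipschitzOnWith.of_le_add fun x hx y hy => ?_)
  rw [Real.dist_eq]
  rcases le_total x y with h | h
  · linarith [service_mono hm hx h, abs_nonneg (x - y)]
  · linarith [service_le_add hm hy h, le_abs_self (x - y)]

/-- The last time at which the service is at most `c`. -/
theorem exists_last_service_eq (hm : MeasurableSet {t | σ t = some J}) (hρ : ρ ≤ u) {c : ℝ}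
    (hc0 : 0 ≤ c) (hc : c < service σ J ρ u) :
    ∃ a, ρ ≤ a ∧ a < u ∧ service σ J ρ a = c ∧ ∀ s, a < s → s ≤ u → c < service σ J ρ s := by
  have hcl : IsCompact (Icc ρ u ∩ service σ J ρ ⁻¹' Iic c) :=
    isCompact_Icc.of_isClosed_subset
      (((continuousOn_service hm).mono Icc_subset_Ici_self).preimage_isClosed_of_isClosed
        isClosed_Icc isClosed_Iic) inter_subset_left
  obtain ⟨a, ⟨⟨⟨h1, h2⟩, h3⟩, h4⟩⟩ := hcl.exists_isGreatest
    ⟨ρ, ⟨le_rfl, hρ⟩, by simpa [service_self] using hc0⟩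
  have h5 : ∀ s, a < s → s ≤ u → c < service σ J ρ s := by
    intro s hs hsu
    by_contra! hle
    exact absurd (h4 ⟨⟨h1.trans hs.le, hsu⟩, hle⟩) (not_le.2 hs)
  have hau : a < u := by
    rcases h2.lt_or_eq with h | h
    · exact h
    · rw [h] at h3; exact absurd h3 (not_le.2 hc)
  refine ⟨a, h1, hau, le_antisymm h3 ?_, h5⟩
  refine le_of_forall_pos_lt_add fun ε hε => ?_
  have hs : a < min u (a + ε) := lt_min hau (by linarith)
  have h6 := h5 _ hs (min_le_left _ _)
  have h7 := service_le_add hm h1 hs.le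
  linarith [min_le_right u (a + ε)]

end Service

/-! ### Attempts -/

/-- There is an attempt that begins at `ρ` and is not disturbed by a restart before `u`. -/
def Epoch (R : Set ℝ) (ρ u : ℝ) : Prop :=
  (ρ = 0 ∨ ρ ∈ R) ∧ 0 ≤ ρ ∧ ρ ≤ u ∧ ∀ r ∈ R, ¬ (ρ < r ∧ r < u)

variable {R : Set ℝ} {e : Fin n × ℕ → ℝ → ℝ} {σ : ℝ → Option (Fin n × ℕ)} {J J' : Fin n × ℕ}
  {ρ ρ' s t u v : ℝ}

theorem Epoch.mono (h : Epoch R ρ u) (h1 : ρ ≤ s) (h2 : s ≤ u) : Epoch R ρ s :=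
  ⟨h.1, h.2.1, h1, fun r hr hc => h.2.2.2 r hr ⟨hc.1, hc.2.trans_le h2⟩⟩

theorem Epoch.lastStart (h : Epoch R ρ u) (h1 : ρ ≤ s) (h2 : s < u) : LastStart R ρ s :=
  ⟨h.1, h1, fun r hr hrs => not_lt.1 fun hc => h.2.2.2 r hr ⟨hc, hrs.trans_lt h2⟩⟩

theorem LastStart.nonneg (hR : ∀ r ∈ R, 0 ≤ r) (h : LastStart R ρ t) : 0 ≤ ρ := by
  rcases h.1 with h0 | h0
  · exact h0.ge
  · exact hR _ h0

theorem LastStart.epoch (hR : ∀ r ∈ R, 0 ≤ r) (h : LastStart R ρ t) : Epoch R ρ t :=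
  ⟨h.1, h.nonneg hR, h.2.1, fun r hr hc => absurd (h.2.2 r hr hc.2.le) (not_le.2 hc.1)⟩

theorem LastStart.unique (hR : ∀ r ∈ R, 0 ≤ r) (h : LastStart R ρ t) (h' : LastStart R ρ' t) :
    ρ = ρ' := by
  have key : ∀ {a b : ℝ}, LastStart R a t → LastStart R b t → a ≤ b := by
    intro a b ha hb
    rcases ha.1 with h0 | h0
    · rw [h0]; exact hb.nonneg hR
    · exact hb.2.2 a h0 ha.2.1
  exact le_antisymm (key h h') (key h' h)

/-- Separation prevents accumulation: a restart within `δ` of the supremum of those up to `t` has no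
successor up to `t`. -/
theorem exists_lastStart {δ : ℝ} (hδ : 0 < δ)
    (hsep : ∀ r ∈ R, ∀ r' ∈ R, r < r' → δ ≤ r' - r) (ht : 0 ≤ t) :
    ∃ ρ, LastStart R ρ t := by
  by_cases hne : ({r | r ∈ R ∧ r ≤ t}).Nonempty
  · have hbdd : BddAbove {r | r ∈ R ∧ r ≤ t} := ⟨t, fun r hr => hr.2⟩
    obtain ⟨r, ⟨hr, hrt⟩, hlt⟩ := exists_lt_of_lt_csSup hne (sub_lt_self _ hδ)
    refine ⟨r, Or.inr hr, hrt, fun r' hr' hrt' => not_lt.1 fun hc => ?_⟩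
    have := hsep r hr r' hr' hc
    have := le_csSup hbdd (⟨hr', hrt'⟩ : r' ∈ {r | r ∈ R ∧ r ≤ t})
    linarith
  · refine ⟨0, Or.inl rfl, ht, fun r hr hrt => absurd ⟨r, hr, hrt⟩ hne⟩

theorem Completed.mono (h : Completed R e σ J s) (hst : s ≤ t) : Completed R e σ J t := by
  obtain ⟨ρ, u, h1, h2, h3, h4, h5⟩ := h
  exact ⟨ρ, u, h1, h2, h3, h4.trans hst, h5⟩

theorem Epoch.completed (h : Epoch R ρ u) (he : e J ρ ≤ service σ J ρ u) :
    Completed R e σ J u :=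
  ⟨ρ, u, h.1, h.2.1, h.2.2.1, le_rfl, h.2.2.2, he⟩

variable {τ}

theorem Epoch.nonPreemptive_iff (hR : ∀ r ∈ R, 0 ≤ r) (h : Epoch R ρ u) (h1 : ρ ≤ s)
    (h2 : s < u) : τ.NonPreemptive R e σ J s ↔
      τ.Pending R e σ J s ∧ τ.C J.1 - τ.Q J.1 < service σ J ρ s := by
  constructor
  · rintro ⟨hp, ρ', hρ', hs⟩
    rw [hρ'.unique hR (h.lastStart h1 h2)] at hs
    exact ⟨hp, hs⟩
  · rintro ⟨hp, hs⟩
    exact ⟨hp, ρ, h.lastStart h1 h2, hs⟩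

/-! ### Execution within one attempt and non-preemptive regions. -/

namespace IsFPSchedule

theorem pending (hσ : τ.IsFPSchedule R e σ) (ht : 0 ≤ t) (h : σ t = some J) :
    τ.Pending R e σ J t := (hσ.eligible t ht J h).1

theorem service_eq_zero_of_completed (hσ : τ.IsFPSchedule R e σ) (hu : 0 ≤ u)
    (h : Completed R e σ J u) : service σ J u v = 0 :=
  service_eq_zero fun _ hs hc => (hσ.pending (hu.trans hs.1) hc).2 (h.mono hs.1)

/-- When the service reaches `e J ρ` the job is complete, and a complete job is never executed
again. -/
theorem service_le_exec (hσ : τ.IsFPSchedule R e σ) (he : τ.ValidExec e) (h : Epoch R ρ u) :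
    service σ J ρ u ≤ e J ρ := by
  by_contra! hc
  obtain ⟨a, h1, h2, h3, -⟩ :=
    exists_last_service_eq (hσ.measurable J) h.2.2.1 (he J ρ).1.le hc
  have h4 := hσ.service_eq_zero_of_completed (v := u) (h.2.1.trans h1)
    ((h.mono h1 h2.le).completed h3.ge)
  have h5 := service_add (hσ.measurable J) h1 h2.le
  linarith

/-- At the last instant with service exactly `C - Q` the job must be running: otherwise
right-constancy would keep the service at `C - Q` a little longer. -/
theorem exists_running_of_C_sub_Q_lt (hσ : τ.IsFPSchedule R e σ) (h : Epoch R ρ u)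
    (hs : τ.C J.1 - τ.Q J.1 < service σ J ρ u) :
    ∃ a, ρ ≤ a ∧ a < u ∧ service σ J ρ a = τ.C J.1 - τ.Q J.1 ∧ σ a = some J ∧
      ∀ s, a < s → s ≤ u → τ.C J.1 - τ.Q J.1 < service σ J ρ s := by
  obtain ⟨a, h1, h2, h3, h4⟩ :=
    exists_last_service_eq (hσ.measurable J) h.2.2.1 (sub_nonneg.2 (τ.Q_le_C J.1)) hs
  refine ⟨a, h1, h2, h3, ?_, h4⟩
  obtain ⟨ε, hε, hc⟩ := hσ.right_constant a (h.2.1.trans h1)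
  by_contra hne
  have hlt : a < min u (a + ε) := lt_min h2 (by linarith)
  have h5 := h4 _ hlt (min_le_left _ _)
  rw [service_add (hσ.measurable J) h1 hlt.le, service_eq_zero (ρ := a), h3] at h5
  · linarith
  · intro s hs
    rw [hc s ⟨hs.1, hs.2.trans_le (min_le_right _ _)⟩]
    exact hne

/-- A job that has executed for longer than `C - Q` and is not complete has been running since it
had executed for `C - Q` time units, and at that time it was chosen because of its priority. -/
theorem exists_running_on (hσ : τ.IsFPSchedule R e σ) (hR : ∀ r ∈ R, 0 ≤ r) (h : Epoch R ρ u)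
    (hs : τ.C J.1 - τ.Q J.1 < service σ J ρ u) (hJ : ¬ Completed R e σ J u) :
    ∃ a, ρ ≤ a ∧ a < u ∧ service σ J ρ a = τ.C J.1 - τ.Q J.1 ∧
      (∀ J', τ.Pending R e σ J' a → J.1 ≤ J'.1) ∧ ∀ s ∈ Ico a u, σ s = some J := by
  obtain ⟨a, h1, h2, h3, h4, h5⟩ := hσ.exists_running_of_C_sub_Q_lt h hs
  have ha0 : 0 ≤ a := h.2.1.trans h1
  have hel := hσ.eligible a ha0 J h4
  -- The region begins strictly above `C - Q`, so at the threshold itself the job still had to be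
  -- chosen by priority.
  have hnp : ¬ τ.NonPreemptive R e σ J a := by
    rw [h.nonPreemptive_iff hR h1 h2, h3]
    exact fun hc => lt_irrefl _ hc.2
  obtain ⟨hno, htop⟩ := hel.2.2.resolve_left hnp
  have hJs : ∀ s ≤ u, ¬ Completed R e σ J s := fun s hs hc => hJ (hc.mono hs)
  have hrel : τ.release J ≤ a := hel.1.1
  have hNP : ∀ s, a < s → s < u → τ.NonPreemptive R e σ J s := fun s has hsu =>
    (h.nonPreemptive_iff hR (h1.trans has.le) hsu).2
      ⟨⟨hrel.trans has.le, hJs s hsu.le⟩, h5 s has hsu.le⟩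
  refine ⟨a, h1, h2, h3, htop, ?_⟩
  rintro s ⟨has, hsu⟩
  rcases has.eq_or_lt with rfl | has
  · exact h4
  have hs0 : 0 ≤ s := ha0.trans has.le
  have hreb : ¬ τ.Rebooting R s := by
    rintro ⟨r, hr, hrs, hsr⟩
    have hra : r ≤ a := (h.lastStart (h1.trans has.le) hsu).2.2 r hr hrs |>.trans h1
    have := hσ.rebooting a ha0 ⟨r, hr, hra, has.trans hsr⟩
    rw [h4] at this
    exact absurd this (by simp)
  have hne := hσ.work_conserving s hs0 hreb ⟨J, (hNP s has hsu).1⟩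
  obtain ⟨J', hJ'⟩ := Option.ne_none_iff_exists'.1 hne
  rw [hJ']
  by_contra hJJ
  have hJJ : J' ≠ J := fun hc => hJJ (by rw [hc])
  have hnp' : τ.NonPreemptive R e σ J' s :=
    (hσ.eligible s hs0 J' hJ').2.2.resolve_right fun hc => hc.1 J (hNP s has hsu)
  have hρs : ρ ≤ s := h1.trans has.le
  have hser := ((h.nonPreemptive_iff hR hρs hsu).1 hnp').2
  obtain ⟨a', g1, g2, g3, g4, g5⟩ := hσ.exists_running_of_C_sub_Q_lt (h.mono hρs hsu.le) hser
  have hnpa' : ¬ τ.NonPreemptive R e σ J' a' := by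
    rw [h.nonPreemptive_iff hR g1 (g2.trans hsu), g3]
    exact fun hc => lt_irrefl _ hc.2
  -- Both jobs would have crossed their thresholds by `s`. The one that crossed first was already
  -- non-preemptive when the other crossed, so the other could not have been chosen; a tie would
  -- mean that both ran at once.
  rcases lt_trichotomy a' a with hlt | heq | hgt
  · have hpa : τ.Pending R e σ J' a :=
      ⟨(hσ.pending (h.2.1.trans g1) g4).1.trans hlt.le, fun hc => hnp'.1.2 (hc.mono has.le)⟩
    exact hno J' ((h.nonPreemptive_iff hR h1 h2).2 ⟨hpa, g5 a hlt has.le⟩)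
  · rw [heq, h4] at g4
    exact hJJ (Option.some.inj g4).symm
  · have := (hσ.eligible a' (h.2.1.trans g1) J' g4).2.2.resolve_left hnpa'
    exact this.1 J (hNP a' hgt (g2.trans hsu))

end IsFPSchedule

end TaskSet

namespace TaskSet

variable {n : ℕ} (τ : TaskSet n)

/-! ### Releases -/

theorem release_mono (i : Fin n) {k l : ℕ} (h : k ≤ l) : τ.release (i, k) ≤ τ.release (i, l) := by
  have : (k : ℝ) ≤ l := by exact_mod_cast h
  simp only [release]
  nlinarith [τ.T_pos i]

theorem release_nonneg (J : Fin n × ℕ) : 0 ≤ τ.release J :=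
  add_nonneg (τ.φ_nonneg _) (mul_nonneg (Nat.cast_nonneg _) (τ.T_pos _).le)

/-- The numbers of the jobs of task `j` that are released in `[a, b)`. -/
noncomputable def releasedIn (j : Fin n) (a b : ℝ) : Finset ℕ :=
  Finset.Ico ⌈(a - τ.φ j) / τ.T j⌉₊ ⌈(b - τ.φ j) / τ.T j⌉₊

theorem ceil_le_iff_le_release {j : Fin n} {a : ℝ} {k : ℕ} :
    ⌈(a - τ.φ j) / τ.T j⌉₊ ≤ k ↔ a ≤ τ.release (j, k) := by
  rw [Nat.ceil_le, div_le_iff₀ (τ.T_pos j), release, sub_le_iff_le_add']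

theorem mem_releasedIn {j : Fin n} {a b : ℝ} {k : ℕ} :
    k ∈ τ.releasedIn j a b ↔ a ≤ τ.release (j, k) ∧ τ.release (j, k) < b := by
  rw [releasedIn, Finset.mem_Ico, ceil_le_iff_le_release, ← not_le (b := k),
    ceil_le_iff_le_release, not_le]

theorem card_releasedIn_le {j : Fin n} {a b : ℝ} (h : a ≤ b) :
    ((τ.releasedIn j a b).card : ℝ) ≤ ⌈(b - a) / τ.T j⌉ := by
  have h1 : ⌈(b - τ.φ j) / τ.T j⌉₊ ≤ ⌈(b - a) / τ.T j⌉₊ + ⌈(a - τ.φ j) / τ.T j⌉₊ := by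
    have : (b - τ.φ j) / τ.T j = (b - a) / τ.T j + (a - τ.φ j) / τ.T j := by
      rw [← add_div]; ring
    rw [this]
    exact Nat.ceil_add_le _ _
  have h2 : (τ.releasedIn j a b).card ≤ ⌈(b - a) / τ.T j⌉₊ := by
    rw [releasedIn, Nat.card_Ico]
    omega
  have h3 : 0 ≤ (b - a) / τ.T j := div_nonneg (sub_nonneg.2 h) (τ.T_pos j).le
  rw [← natCast_ceil_eq_intCast_ceil h3]
  exact_mod_cast h2

/-- The jobs with numbers in `I j` of the tasks `j ≤ i`. -/
def jobsUpTo (i : Fin n) (I : Fin n → Finset ℕ) : Finset (Fin n × ℕ) :=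
  ((Finset.Iic i).sigma I).map (Equiv.sigmaEquivProd (Fin n) ℕ).toEmbedding

theorem mem_jobsUpTo {i : Fin n} {I : Fin n → Finset ℕ} {J : Fin n × ℕ} :
    J ∈ jobsUpTo i I ↔ J.1 ≤ i ∧ J.2 ∈ I J.1 := by
  rw [jobsUpTo, Finset.mem_map_equiv]
  simp

theorem sum_jobsUpTo {i : Fin n} {I : Fin n → Finset ℕ} (g : Fin n × ℕ → ℝ) :
    ∑ J ∈ jobsUpTo i I, g J = ∑ j ∈ Finset.Iic i, ∑ k ∈ I j, g (j, k) := by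
  rw [jobsUpTo, Finset.sum_map, Finset.sum_sigma]
  rfl

variable {τ}
variable {R : Set ℝ} {e : Fin n × ℕ → ℝ → ℝ} {σ : ℝ → Option (Fin n × ℕ)} {J J' : Fin n × ℕ}
  {ρ ρ' s t u v : ℝ} {i : Fin n} {a b r : ℝ}

/-! ### Wasted execution -/

open Classical in
/-- Execution in an attempt from `ρ` to `r` that is lost by a restart at `r`. -/
noncomputable def wasted (R : Set ℝ) (e : Fin n × ℕ → ℝ → ℝ)
    (σ : ℝ → Option (Fin n × ℕ)) (ρ r : ℝ) (J : Fin n × ℕ) : ℝ :=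
  if Completed R e σ J r then 0 else service σ J ρ r

theorem wasted_nonneg : 0 ≤ wasted R e σ ρ r J := by
  rw [wasted]
  split_ifs
  · exact le_rfl
  · exact service_nonneg

theorem wasted_pos (h : 0 < wasted R e σ ρ r J) :
    ¬ Completed R e σ J r ∧ wasted R e σ ρ r J = service σ J ρ r := by
  rw [wasted] at h ⊢
  split_ifs at h ⊢ with hc
  · exact absurd h (lt_irrefl _)
  · exact ⟨hc, rfl⟩

namespace IsFPSchedule

theorem service_eq_zero_of_earlier (hσ : τ.IsFPSchedule R e σ) (hρ : 0 ≤ ρ) {m : Fin n} {k l : ℕ}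
    (hkl : k < l) (hk : ¬ Completed R e σ (m, k) r) : service σ (m, l) ρ r = 0 := by
  refine service_eq_zero fun s hs hc => ?_
  have hel := hσ.eligible s (hρ.trans hs.1) _ hc
  exact hel.2.1 k hkl ⟨(τ.release_mono m hkl.le).trans hel.1.1, fun h => hk (h.mono hs.2.le)⟩

/-- When `J` crossed its threshold no higher-priority job was pending, so `J'` cannot have run
earlier; afterwards `J` occupied the processor. -/
theorem service_eq_zero_of_nonPreemptive (hσ : τ.IsFPSchedule R e σ) (hR : ∀ r ∈ R, 0 ≤ r)
    (h : Epoch R ρ r) (hs : τ.C J.1 - τ.Q J.1 < service σ J ρ r) (hJ : ¬ Completed R e σ J r)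
    (hJ' : ¬ Completed R e σ J' r) (hlt : J'.1 < J.1) : service σ J' ρ r = 0 := by
  obtain ⟨c, h1, h2, -, h4, h5⟩ := hσ.exists_running_on hR h hs hJ
  refine service_eq_zero fun s hs hc => ?_
  rcases lt_or_ge s c with hsc | hsc
  · have hp := hσ.pending (h.2.1.trans hs.1) hc
    exact absurd (h4 J' ⟨hp.1.trans hsc.le, fun hc => hJ' (hc.mono h2.le)⟩) (not_le.2 hlt)
  · have := h5 s ⟨hsc, hs.2⟩
    rw [hc] at this
    rw [Option.some.inj this] at hlt
    exact lt_irrefl _ hlt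

/-- At most one job of a task contributes to the wasted execution. -/
theorem sum_wasted_task (hσ : τ.IsFPSchedule R e σ) (h : Epoch R ρ r)
    {m : Fin n} (F : Finset (Fin n × ℕ)) (hF : ∀ J ∈ F, J.1 = m) :
    ∑ J ∈ F, wasted R e σ ρ r J = 0 ∨ ∃ J, J.1 = m ∧ ¬ Completed R e σ J r ∧
      ∑ J ∈ F, wasted R e σ ρ r J = service σ J ρ r := by
  by_cases hex : ∃ J ∈ F, 0 < wasted R e σ ρ r J
  · obtain ⟨⟨j, k⟩, hJF, hJ⟩ := hex
    obtain ⟨hc, hw⟩ := wasted_pos hJ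
    refine Or.inr ⟨(j, k), hF _ hJF, hc, ?_⟩
    rw [← hw]
    refine Finset.sum_eq_single _ ?_ fun hn => absurd hJF hn
    rintro ⟨j', l⟩ hJ' hne
    obtain rfl : j = m := hF _ hJF
    obtain rfl : j' = j := hF _ hJ'
    by_contra h0
    obtain ⟨hc', hw'⟩ := wasted_pos (lt_of_le_of_ne wasted_nonneg (Ne.symm h0))
    rcases lt_trichotomy k l with hkl | rfl | hkl
    · rw [hw', hσ.service_eq_zero_of_earlier h.2.1 hkl hc] at h0
      exact h0 rfl
    · exact hne rfl
    · rw [hw, hσ.service_eq_zero_of_earlier h.2.1 hkl hc'] at hJ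
      exact lt_irrefl _ hJ
  · push Not at hex
    exact Or.inl (Finset.sum_eq_zero fun J hJ => le_antisymm (hex J hJ) wasted_nonneg)

/-- This explains the maximum in `WCWE`. If the interrupted job of the lowest task had executed for
at most `C - Q`, the waste of the higher tasks adds to it; if it had executed for longer, it wastes
at most `C` and the higher tasks waste nothing. -/
theorem sum_wasted_filter_le (hσ : τ.IsFPSchedule R e σ) (hR : ∀ r ∈ R, 0 ≤ r)
    (he : τ.ValidExec e) (h : Epoch R ρ r) (F : Finset (Fin n × ℕ)) :
    ∀ (m : ℕ) (hm : m < n),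
      ∑ J ∈ F.filter (fun J => (J.1 : ℕ) ≤ m), wasted R e σ ρ r J ≤ τ.wcweAux m hm := by
  have hcap : ∀ J : Fin n × ℕ, service σ J ρ r ≤ τ.C J.1 := fun J =>
    (hσ.service_le_exec he h).trans (he J ρ).2
  intro m
  induction m with
  | zero =>
    intro hm
    rw [wcweAux]
    rcases hσ.sum_wasted_task h (m := ⟨0, hm⟩) (F.filter (fun J => (J.1 : ℕ) ≤ 0))
      (fun J hJ => Fin.ext (by simpa using (Finset.mem_filter.1 hJ).2)) with h0 | ⟨J, hJ, -, h0⟩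
    · rw [h0]; exact (τ.C_pos _).le
    · rw [h0, ← hJ]; exact hcap J
  | succ m ih =>
    intro hm
    rw [wcweAux]
    have hsplit : F.filter (fun J => (J.1 : ℕ) ≤ m + 1) =
        F.filter (fun J => (J.1 : ℕ) ≤ m) ∪ F.filter (fun J => (J.1 : ℕ) = m + 1) := by
      rw [← Finset.filter_or]
      exact Finset.filter_congr fun J _ => by omega
    have hdisj : Disjoint (F.filter (fun J => (J.1 : ℕ) ≤ m))
        (F.filter (fun J => (J.1 : ℕ) = m + 1)) :=
      Finset.disjoint_filter.2 fun J _ h1 h2 => by omega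
    rw [hsplit, Finset.sum_union hdisj]
    have ih' := ih (Nat.lt_of_succ_lt hm)
    have hmax0 := le_max_left (0 : ℝ) (τ.wcweAux m (Nat.lt_of_succ_lt hm) - τ.Q ⟨m + 1, hm⟩)
    have hmax1 := le_max_right (0 : ℝ) (τ.wcweAux m (Nat.lt_of_succ_lt hm) - τ.Q ⟨m + 1, hm⟩)
    have hQC := τ.Q_le_C ⟨m + 1, hm⟩
    rcases hσ.sum_wasted_task h (m := ⟨m + 1, hm⟩) (F.filter (fun J => (J.1 : ℕ) = m + 1))
      (fun J hJ => Fin.ext (Finset.mem_filter.1 hJ).2) with h0 | ⟨J, hJ, hJc, h0⟩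
    · rw [h0]; linarith
    · rw [h0]
      have hJ1 := hcap J
      rcases le_or_gt (service σ J ρ r) (τ.C J.1 - τ.Q J.1) with hle | hgt
      · rw [hJ] at hle; linarith
      · have hz : ∑ J ∈ F.filter (fun J => (J.1 : ℕ) ≤ m), wasted R e σ ρ r J = 0 := by
          refine Finset.sum_eq_zero fun J' hJ' => ?_
          rw [wasted]
          split_ifs with hc
          · rfl
          · refine hσ.service_eq_zero_of_nonPreemptive hR h hgt hJc hc ?_
            rw [hJ, Fin.lt_def]
            have := (Finset.mem_filter.1 hJ').2
            exact Nat.lt_succ_of_le this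
        rw [hz]
        rw [hJ] at hJ1
        linarith

theorem sum_wasted_le (hσ : τ.IsFPSchedule R e σ) (hR : ∀ r ∈ R, 0 ≤ r)
    (he : τ.ValidExec e) (h : Epoch R ρ r) (F : Finset (Fin n × ℕ)) (hF : ∀ J ∈ F, J.1 ≤ i) :
    ∑ J ∈ F, wasted R e σ ρ r J ≤ τ.WCWE i := by
  have := hσ.sum_wasted_filter_le hR he h F i i.isLt
  rwa [Finset.filter_true_of_mem fun J hJ => Fin.le_def.1 (hF J hJ)] at this

end IsFPSchedule

/-! ### Processor demand in a busy window -/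

/-- At `a`, all jobs of the tasks up to `i` that were released earlier are complete, and no reboot
is going on; in `(a, b)`, the system reboots or has pending jobs of these tasks. -/
structure BusyWindow (τ : TaskSet n) (R : Set ℝ) (e : Fin n × ℕ → ℝ → ℝ)
    (σ : ℝ → Option (Fin n × ℕ)) (i : Fin n) (a b : ℝ) : Prop where
  nonneg : 0 ≤ a
  quiet : ∀ J : Fin n × ℕ, J.1 ≤ i → τ.release J < a → Completed R e σ J a
  not_rebooting : ∀ r ∈ R, ¬ (r < a ∧ a < r + τ.Cr)
  busy : ∀ s ∈ Ioo a b, τ.Rebooting R s ∨ ∃ J, J.1 ≤ i ∧ τ.Pending R e σ J s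

namespace BusyWindow

theorem not_rebooting_of_ne_none (hσ : τ.IsFPSchedule R e σ) (hs : 0 ≤ s) (h : σ s = some J) :
    ¬ τ.Rebooting R s := fun hc => by
  have := hσ.rebooting s hs hc
  rw [h] at this
  exact absurd this (by simp)

/-- With a job of a task up to `i` pending, a lower-priority job runs only in its ending region. Its
threshold instant is at most `a`, because priority would have excluded it inside the window, and it
runs without a break for at most `Q` from there. -/
theorem sub_le_B (w : BusyWindow τ R e σ i a b) (hσ : τ.IsFPSchedule R e σ)
    (hR : ∀ r ∈ R, 0 ≤ r) (he : τ.ValidExec e) (hs : s ∈ Ioo a b) (hJ : σ s = some J)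
    (hi : i < J.1) : s - a ≤ τ.B i := by
  have hs0 : 0 ≤ s := w.nonneg.trans hs.1.le
  obtain ⟨J₁, hJ₁, hp₁⟩ :=
    (w.busy s hs).resolve_left (not_rebooting_of_ne_none hσ hs0 hJ)
  obtain ⟨hp, ρ, hρ, hser⟩ := (hσ.eligible s hs0 J hJ).2.2.resolve_right
    fun hc => absurd ((hc.2 J₁ hp₁).trans hJ₁) (not_le.2 hi)
  have hE := hρ.epoch hR
  obtain ⟨c, h1, h2, h3, h4, h5⟩ := hσ.exists_running_on hR hE hser hp.2
  have hca : c ≤ a := by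
    by_contra! hc
    obtain ⟨J₂, hJ₂, hp₂⟩ := (w.busy c ⟨hc, h2.trans hs.2⟩).resolve_left
      (not_rebooting_of_ne_none hσ (hE.2.1.trans h1) (h5 c ⟨le_rfl, h2⟩))
    exact absurd ((h4 J₂ hp₂).trans hJ₂) (not_le.2 hi)
  have h6 := service_add (hσ.measurable J) h1 h2.le
  rw [service_eq_sub h2.le h5] at h6
  have h7 := hσ.service_le_exec he hE (J := J)
  have h8 := (he J ρ).2
  linarith [τ.Q_le_B hi]

/-- The window is covered by `[a, a + B]`, the reboot interval and the execution times of the jobs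
in `F`; the bound compares Lebesgue measures. -/
theorem sub_le_sum (w : BusyWindow τ R e σ i a b) (hσ : τ.IsFPSchedule R e σ)
    (hR : ∀ r ∈ R, 0 ≤ r) (he : τ.ValidExec e) {p q : ℝ} (hpq : p ≤ q)
    (hreb : ∀ s ∈ Ioo a b, τ.Rebooting R s → s ∈ Ico p q) (F : Finset (Fin n × ℕ))
    (hF : ∀ s ∈ Ioo a b, ∀ J, σ s = some J → J.1 ≤ i → J ∈ F) :
    b - a ≤ τ.B i + (q - p) + ∑ J ∈ F, service σ J a b := by
  have hsub : Ioo a b ⊆ (Icc a (a + τ.B i) ∪ Ico p q) ∪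
      ⋃ J ∈ F, {s | s ∈ Ico a b ∧ σ s = some J} := by
    intro s hs
    by_cases hr : τ.Rebooting R s
    · exact Or.inl (Or.inr (hreb s hs hr))
    obtain ⟨J₁, -, hp₁⟩ := (w.busy s hs).resolve_left hr
    obtain ⟨J, hJ⟩ := Option.ne_none_iff_exists'.1
      (hσ.work_conserving s (w.nonneg.trans hs.1.le) hr ⟨J₁, hp₁⟩)
    rcases le_or_gt J.1 i with hi | hi
    · exact Or.inr (mem_biUnion (hF s hs J hJ hi) ⟨Ioo_subset_Ico_self hs, hJ⟩)
    · have := w.sub_le_B hσ hR he hs hJ hi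
      exact Or.inl (Or.inl ⟨hs.1.le, by linarith⟩)
  have hsum : 0 ≤ ∑ J ∈ F, service σ J a b := Finset.sum_nonneg fun _ _ => service_nonneg
  have h1 : ENNReal.ofReal (b - a) ≤
      ENNReal.ofReal (τ.B i + (q - p) + ∑ J ∈ F, service σ J a b) := by
    rw [ENNReal.ofReal_add (add_nonneg (τ.B_nonneg i) (sub_nonneg.2 hpq)) hsum,
      ENNReal.ofReal_add (τ.B_nonneg i) (sub_nonneg.2 hpq),
      ENNReal.ofReal_sum_of_nonneg fun _ _ => service_nonneg, ← Real.volume_Ioo]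
    refine (measure_mono hsub).trans ((measure_union_le _ _).trans (add_le_add
      ((measure_union_le _ _).trans (add_le_add ?_ ?_)) ?_))
    · rw [Real.volume_Icc]; simp
    · rw [Real.volume_Ico]
    · refine (measure_biUnion_finset_le _ _).trans (Finset.sum_le_sum fun J _ => ?_)
      rw [ofReal_service]
  exact (ENNReal.ofReal_le_ofReal_iff
    (add_nonneg (add_nonneg (τ.B_nonneg i) (sub_nonneg.2 hpq)) hsum)).1 h1

/-- Processor demand in a busy window with at most one restart: `o` accounts for the overhead of
the restart and `y` for the execution of the jobs in their last attempts, the last of which began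
at `ρ`. -/
theorem exists_demand (w : BusyWindow τ R e σ i a b) (hσ : τ.IsFPSchedule R e σ)
    (hR : ∀ r ∈ R, 0 ≤ r) (he : τ.ValidExec e) (hab : a ≤ b)
    (hL : ∀ t, 0 ≤ t → ∃ ρ, LastStart R ρ t)
    (huniq : ∀ r ∈ R, ∀ r' ∈ R, a ≤ r → r < r' → r' < b → False)
    (hcrit : ∀ r ∈ R, τ.Critical i) (F : Finset (Fin n × ℕ)) (hFi : ∀ J ∈ F, J.1 ≤ i)
    (hF : ∀ s ∈ Ioo a b, ∀ J, σ s = some J → J.1 ≤ i → J ∈ F) :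
    ∃ (ρ o : ℝ) (y : Fin n × ℕ → ℝ), Epoch R ρ b ∧ (∀ J, y J ≤ τ.C J.1) ∧
      (∀ J, ¬ Completed R e σ J b → y J ≤ service σ J ρ b) ∧
      b - a ≤ τ.B i + o + ∑ J ∈ F, y J ∧ o ≤ τ.overhead i ∧
      (∀ r ∈ R, r < b → b < r + τ.Cr → o < τ.overhead i) ∧
      ((∀ r ∈ R, a ≤ r → b ≤ r) → o = 0) := by
  obtain ⟨ρ, hρ⟩ := hL a w.nonneg
  have hρ0 := hρ.nonneg hR
  by_cases hex : ∃ r ∈ R, a ≤ r ∧ r < b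
  · obtain ⟨r, hr, har, hrb⟩ := hex
    have hur : ∀ r' ∈ R, a ≤ r' → r' < b → r' = r := by
      intro r' hr' h1 h2
      rcases lt_trichotomy r' r with h | h | h
      · exact (huniq r' hr' r hr h1 h hrb).elim
      · exact h
      · exact (huniq r hr r' hr' har h h2).elim
    have hE1 : Epoch R ρ r := by
      refine ⟨hρ.1, hρ0, hρ.2.1.trans har, fun r' hr' hc => ?_⟩
      rcases le_or_gt r' a with h | h
      · exact absurd (hρ.2.2 r' hr' h) (not_le.2 hc.1)
      · exact absurd (hur r' hr' h.le (hc.2.trans hrb)) hc.2.ne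
    have hE2 : Epoch R r b := ⟨Or.inr hr, hR r hr, hrb.le, fun r' hr' hc =>
      absurd (hur r' hr' (har.trans hc.1.le) hc.2) hc.1.ne'⟩
    have hcap : ∀ {ρ' b'} (J : Fin n × ℕ), Epoch R ρ' b' → service σ J ρ' b' ≤ τ.C J.1 :=
      fun J h => (hσ.service_le_exec he h).trans (he J _).2
    classical
    have hO := τ.overhead_of_critical (hcrit r hr)
    have hmin : min (r + τ.Cr) b - r ≤ τ.Cr := by linarith [min_le_left (r + τ.Cr) b]
    -- Only the part of the reboot before `b` is charged, so that `o` is strictly smaller if the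
    -- reboot is unfinished at `b`. A job completed by `r` is charged in full; any other job is
    -- charged its service since `r`, and its earlier service counts as waste.
    refine ⟨r, (min (r + τ.Cr) b - r) + τ.WCWE i,
      fun J => if Completed R e σ J r then τ.C J.1 else service σ J r b, hE2, ?_, ?_, ?_, ?_, ?_,
      fun hno => absurd (hno r hr har) (not_le.2 hrb)⟩
    · intro J
      dsimp only
      split_ifs
      · exact le_rfl
      · exact hcap J hE2
    · intro J hJ
      dsimp only
      rw [if_neg fun hc => hJ (hc.mono hrb.le)]
    · have hreb : ∀ s ∈ Ioo a b, τ.Rebooting R s → s ∈ Ico r (min (r + τ.Cr) b) := by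
        rintro s hs ⟨r', hr', hrs, hsr⟩
        rcases lt_or_ge r' a with h | h
        · exact absurd ⟨h, hs.1.trans hsr⟩ (w.not_rebooting r' hr')
        · obtain rfl := hur r' hr' h (hrs.trans_lt hs.2)
          exact ⟨hrs, lt_min hsr hs.2⟩
      have h1 := w.sub_le_sum hσ hR he
        (le_min (by linarith [τ.Cr_nonneg]) hrb.le) hreb F hF
      have h2 := hσ.sum_wasted_le hR he hE1 F hFi
      have h3 : ∑ J ∈ F, service σ J a b ≤ ∑ J ∈ F, wasted R e σ ρ r J +
          ∑ J ∈ F, (if Completed R e σ J r then τ.C J.1 else service σ J r b) := by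
        rw [← Finset.sum_add_distrib]
        refine Finset.sum_le_sum fun J _ => ?_
        have h4 := service_mono_left (hσ.measurable J) hρ.2.1 har
        rw [service_add (hσ.measurable J) har hrb.le, wasted]
        split_ifs with hc
        · rw [hσ.service_eq_zero_of_completed (hR r hr) hc]
          linarith [hcap J hE1]
        · linarith
      linarith
    · linarith
    · intro r' hr' h1 h2
      have h3 : a ≤ r' := by
        by_contra! hc
        exact w.not_rebooting r' hr' ⟨hc, hab.trans_lt h2⟩
      obtain rfl := hur r' hr' h3 h1
      rw [min_eq_right h2.le]
      linarith
  · push Not at hex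
    have hE : Epoch R ρ b := by
      refine ⟨hρ.1, hρ0, hρ.2.1.trans hab, fun r' hr' hc => ?_⟩
      rcases le_or_gt r' a with h | h
      · exact absurd (hρ.2.2 r' hr' h) (not_le.2 hc.1)
      · exact absurd (hex r' hr' h.le) (not_le.2 hc.2)
    have hsr : ∀ J, service σ J a b ≤ service σ J ρ b := fun J =>
      service_mono_left (hσ.measurable J) hρ.2.1 hab
    refine ⟨ρ, 0, fun J => service σ J a b, hE,
      fun J => (hsr J).trans ((hσ.service_le_exec he hE).trans (he J _).2), fun J _ => hsr J, ?_,
      τ.overhead_nonneg i, ?_, fun _ => rfl⟩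
    · have hreb : ∀ s ∈ Ioo a b, τ.Rebooting R s → s ∈ Ico a a := by
        rintro s hs ⟨r', hr', hrs, hsr⟩
        rcases lt_or_ge r' a with h | h
        · exact absurd ⟨h, hs.1.trans hsr⟩ (w.not_rebooting r' hr')
        · exact absurd (hex r' hr' h) (not_le.2 (hrs.trans_lt hs.2))
      have h1 := w.sub_le_sum hσ hR he le_rfl hreb F hF
      linarith
    · intro r' hr' h1 h2
      rcases lt_or_ge r' a with h | h
      · exact absurd ⟨h, hab.trans_lt h2⟩ (w.not_rebooting r' hr')
      · exact absurd (hex r' hr' h) (not_le.2 h1)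

end BusyWindow

end TaskSet

namespace TaskSet

variable {n : ℕ} {τ : TaskSet n}
variable {R : Set ℝ} {e : Fin n × ℕ → ℝ → ℝ} {σ : ℝ → Option (Fin n × ℕ)} {J J' : Fin n × ℕ}
  {ρ ρ' s t u v : ℝ} {i : Fin n} {a b r : ℝ}

/-! ### Deadlines -/

/-- A busy window ends at the latest at the release of `J` or when `J` is complete. -/
theorem exists_busyWindow (τ : TaskSet n) (R : Set ℝ) (e : Fin n × ℕ → ℝ → ℝ)
    (σ : ℝ → Option (Fin n × ℕ)) (hR : ∀ r ∈ R, 0 ≤ r) (J : Fin n × ℕ) :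
    ∃ a ≤ τ.release J,
      (∀ b, (b ≤ τ.release J ∨ ¬ Completed R e σ J b) → BusyWindow τ R e σ J.1 a b) ∧
      ∀ b, a < b → b ≤ τ.release J →
        (∃ J' : Fin n × ℕ, J'.1 ≤ J.1 ∧ τ.release J' < b ∧ ¬ Completed R e σ J' b) ∨
          ∃ r ∈ R, r < b ∧ b < r + τ.Cr := by
  set G : Set ℝ := {t | 0 ≤ t ∧ t ≤ τ.release J ∧
    (∀ J' : Fin n × ℕ, J'.1 ≤ J.1 → τ.release J' < t → Completed R e σ J' t) ∧
    ∀ r ∈ R, ¬ (r < t ∧ t < r + τ.Cr)} with hG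
  have h0 : (0 : ℝ) ∈ G := ⟨le_rfl, τ.release_nonneg J,
    fun J' _ h => absurd h (not_lt.2 (τ.release_nonneg J')),
    fun r hr h => absurd h.1 (not_lt.2 (hR r hr))⟩
  have hbdd : BddAbove G := ⟨τ.release J, fun t ht => ht.2.1⟩
  -- The supremum is attained because releases and restarts are compared strictly with `t`: one that
  -- lies before the supremum lies before some element of `G`.
  have ha : sSup G ∈ G := by
    refine ⟨le_csSup hbdd h0, csSup_le ⟨0, h0⟩ fun t ht => ht.2.1, fun J' hJ' h => ?_,
      fun r hr h => ?_⟩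
    · obtain ⟨t, ht, hlt⟩ := exists_lt_of_lt_csSup ⟨0, h0⟩ h
      exact (ht.2.2.1 J' hJ' hlt).mono (le_csSup hbdd ht)
    · obtain ⟨t, ht, hlt⟩ := exists_lt_of_lt_csSup ⟨0, h0⟩ h.1
      exact ht.2.2.2 r hr ⟨hlt, (le_csSup hbdd ht).trans_lt h.2⟩
  have hmax : ∀ b, sSup G < b → b ≤ τ.release J →
        (∃ J' : Fin n × ℕ, J'.1 ≤ J.1 ∧ τ.release J' < b ∧ ¬ Completed R e σ J' b) ∨
          ∃ r ∈ R, r < b ∧ b < r + τ.Cr := by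
    intro b hab hb
    by_contra! hc
    refine absurd (le_csSup hbdd ⟨ha.1.trans hab.le, hb, fun J' hJ' hr => ?_,
      fun r hr h => ?_⟩) (not_le.2 hab)
    · exact hc.1 J' hJ' hr
    · exact absurd h.2 (not_lt.2 (hc.2 r hr h.1))
  refine ⟨sSup G, ha.2.1, fun b hb => ⟨ha.1, ha.2.2.1, ha.2.2.2, ?_⟩, hmax⟩
  rintro s ⟨h1, h2⟩
  rcases le_or_gt s (τ.release J) with h | h
  · rcases hmax s h1 h with ⟨J', h3, h4, h5⟩ | ⟨r, hr, h3, h4⟩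
    · exact Or.inr ⟨J', h3, h4.le, h5⟩
    · exact Or.inl ⟨r, hr, h3.le, h4⟩
  · rcases hb with hb | hb
    · exact absurd (h2.trans_le hb) (not_lt.2 h.le)
    · exact Or.inr ⟨J, le_rfl, h.le, fun hc => hb (hc.mono h2.le)⟩

theorem BusyWindow.le_release (w : BusyWindow τ R e σ i a b) (hσ : τ.IsFPSchedule R e σ)
    (hs : s ∈ Ioo a b) (hJ : σ s = some J) (hi : J.1 ≤ i) :
    a ≤ τ.release J ∧ τ.release J < b := by
  have hp := hσ.pending (w.nonneg.trans hs.1.le) hJ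
  refine ⟨?_, hp.1.trans_lt hs.2⟩
  by_contra! hc
  exact hp.2 ((w.quiet J hi hc).mono hs.1.le)

/-- The start of a busy window is less than `Λ` before the release of the job. -/
theorem release_lt_of_busyDemand_le (hσ : τ.IsFPSchedule R e σ) (hR : ∀ r ∈ R, 0 ≤ r)
    (he : τ.ValidExec e) (hL : ∀ t, 0 ≤ t → ∃ ρ, LastStart R ρ t)
    (hcrit : ∀ r ∈ R, τ.Critical i) {Λ : ℝ} (hΛ : 0 < Λ) (hbd : τ.busyDemand i Λ ≤ Λ)
    (hsep : ∀ r ∈ R, ∀ r' ∈ R, r < r' → Λ ≤ r' - r)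
    (w : BusyWindow τ R e σ i a (a + Λ)) :
    ¬ ((∃ J' : Fin n × ℕ, J'.1 ≤ i ∧ τ.release J' < a + Λ ∧ ¬ Completed R e σ J' (a + Λ)) ∨
          ∃ r ∈ R, r < a + Λ ∧ a + Λ < r + τ.Cr) := by
  intro hbad
  have hab : a ≤ a + Λ := by linarith
  obtain ⟨ρ, o, y, hE, hyC, hys, hdem, hoO, hstr, -⟩ := w.exists_demand hσ hR he hab hL
    (fun r hr r' hr' h1 h2 h3 => by have := hsep r hr r' hr' h2; linarith) hcrit
    (jobsUpTo i fun j => τ.releasedIn j a (a + Λ)) (fun J hJ => (mem_jobsUpTo.1 hJ).1)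
    (fun s hs J hJ hi => mem_jobsUpTo.2 ⟨hi, τ.mem_releasedIn.2 (w.le_release hσ hs hJ hi)⟩)
  have h1 : ∑ J ∈ jobsUpTo i (fun j => τ.releasedIn j a (a + Λ)), τ.C J.1 ≤
      ∑ j ∈ Finset.Iic i, (⌈Λ / τ.T j⌉ : ℝ) * τ.C j := by
    rw [sum_jobsUpTo]
    refine Finset.sum_le_sum fun j _ => ?_
    dsimp only
    rw [Finset.sum_const, nsmul_eq_mul]
    refine mul_le_mul_of_nonneg_right ?_ (τ.C_pos j).le
    have := τ.card_releasedIn_le (j := j) hab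
    rwa [add_sub_cancel_left] at this
  rw [busyDemand] at hbd
  -- Either alternative makes the demand bound strict: an incomplete job has received less than `C`,
  -- and an unfinished reboot has cost less than `Cr`. This contradicts `busyDemand ≤ Λ`.
  rcases hbad with ⟨J', hJ'i, hJ'r, hJ'c⟩ | ⟨r, hr, hr1, hr2⟩
  · have hJa : a ≤ τ.release J' := by
      by_contra! hc
      exact hJ'c ((w.quiet J' hJ'i hc).mono hab)
    have h2 : ∑ J ∈ jobsUpTo i (fun j => τ.releasedIn j a (a + Λ)), y J <
        ∑ J ∈ jobsUpTo i (fun j => τ.releasedIn j a (a + Λ)), τ.C J.1 := by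
      refine Finset.sum_lt_sum (fun J _ => hyC J)
        ⟨J', mem_jobsUpTo.2 ⟨hJ'i, τ.mem_releasedIn.2 ⟨hJa, hJ'r⟩⟩, ?_⟩
      have h3 : service σ J' ρ (a + Λ) < e J' ρ := by
        by_contra! hc
        exact hJ'c (hE.completed hc)
      linarith [hys J' hJ'c, (he J' ρ).2]
    linarith
  · have h2 : ∑ J ∈ jobsUpTo i (fun j => τ.releasedIn j a (a + Λ)), y J ≤
        ∑ J ∈ jobsUpTo i (fun j => τ.releasedIn j a (a + Λ)), τ.C J.1 :=
      Finset.sum_le_sum fun J _ => hyC J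
    linarith [hstr r hr hr1 hr2]

open Filter Topology in
-- `⌊S / T⌋ + 1` counts the releases in a closed window of length `S`, and slightly longer half-open
-- windows have no more. The extra length carries the job strictly past `C - Q`.
theorem eventually_ceil_le_floor_add_one (τ : TaskSet n) (S : ℝ) :
    ∀ᶠ x in 𝓝[>] S, ∀ j, (⌈x / τ.T j⌉ : ℝ) ≤ (⌊S / τ.T j⌋ : ℝ) + 1 := by
  refine Filter.eventually_all.2 fun j => ?_
  have h1 : S < ((⌊S / τ.T j⌋ : ℝ) + 1) * τ.T j := by
    rw [← div_lt_iff₀ (τ.T_pos j)]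
    exact Int.lt_floor_add_one _
  filter_upwards [Ioc_mem_nhdsGT h1] with x hx
  have h2 : ⌈x / τ.T j⌉ ≤ ⌊S / τ.T j⌋ + 1 := by
    rw [Int.ceil_le]
    push_cast
    exact (div_le_iff₀ (τ.T_pos j)).2 hx.2
  exact_mod_cast h2

/-- In a busy window that began at `a`, the job `q` of task `i` has reached its non-preemptive
region shortly after `a + S`. -/
theorem exists_service_ge_of_startDemand (hσ : τ.IsFPSchedule R e σ) (hR : ∀ r ∈ R, 0 ≤ r)
    (he : τ.ValidExec e) (hL : ∀ t, 0 ≤ t → ∃ ρ, LastStart R ρ t)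
    (hcrit : ∀ r ∈ R, τ.Critical i) {q m k : ℕ} {x S : ℝ}
    (w : BusyWindow τ R e σ i a (a + x)) (hx0 : 0 ≤ x)
    (hq : ¬ Completed R e σ (i, q) (a + x))
    (hm : ∀ l, a ≤ τ.release (i, l) → m ≤ l) (hmq : m ≤ q) (hk : k = q + 1 - m)
    (huniq : ∀ r ∈ R, ∀ r' ∈ R, a ≤ r → r < r' → r' < a + x → False)
    (hS : S = τ.startDemand i k S)
    (hx : ∀ j, (⌈x / τ.T j⌉ : ℝ) ≤ (⌊S / τ.T j⌋ : ℝ) + 1) :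
    ∃ ρ o, Epoch R ρ (a + x) ∧ o ≤ τ.overhead i ∧ ((∀ r ∈ R, a ≤ r → a + x ≤ r) → o = 0) ∧
      τ.C i - τ.Q i + (x - S) + (τ.overhead i - o) ≤ service σ (i, q) ρ (a + x) := by
  classical
  have hab : a ≤ a + x := by linarith
  obtain ⟨ρ, o, y, hE, hyC, hys, hdem, hoO, -, ho0⟩ := w.exists_demand hσ hR he hab hL huniq hcrit
    (jobsUpTo i fun j => if j = i then Finset.Icc m q else τ.releasedIn j a (a + x))
    (fun J hJ => (mem_jobsUpTo.1 hJ).1) (by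
      rintro s hs ⟨j, l⟩ hJ hi
      refine mem_jobsUpTo.2 ⟨hi, ?_⟩
      have hrel := w.le_release hσ hs hJ hi
      dsimp only
      split_ifs with hji
      · subst hji
        refine Finset.mem_Icc.2 ⟨hm l hrel.1, ?_⟩
        by_contra! hql
        have hel := hσ.eligible s (w.nonneg.trans hs.1.le) _ hJ
        refine hel.2.1 q hql ⟨(τ.release_mono j hql.le).trans hel.1.1, fun hc => ?_⟩
        exact hq (hc.mono hs.2.le)
      · exact τ.mem_releasedIn.2 hrel)
  refine ⟨ρ, o, hE, hoO, ho0, ?_⟩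
  rw [sum_jobsUpTo, sum_Iic] at hdem
  simp only [if_true] at hdem
  have h1 : ∑ j ∈ Finset.Iio i, ∑ l ∈ (if j = i then Finset.Icc m q
        else τ.releasedIn j a (a + x)), y (j, l) ≤
      ∑ j ∈ Finset.Iio i, ((⌊S / τ.T j⌋ : ℝ) + 1) * τ.C j := by
    refine Finset.sum_le_sum fun j hj => ?_
    rw [if_neg (Finset.mem_Iio.1 hj).ne]
    refine (Finset.sum_le_sum fun l _ => hyC (j, l)).trans ?_
    dsimp only
    rw [Finset.sum_const, nsmul_eq_mul]
    refine mul_le_mul_of_nonneg_right ?_ (τ.C_pos j).le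
    have := τ.card_releasedIn_le (j := j) hab
    rw [add_sub_cancel_left] at this
    exact this.trans (hx j)
  have h2 : ∑ l ∈ Finset.Icc m q, y (i, l) ≤ ((k : ℝ) - 1) * τ.C i + service σ (i, q) ρ (a + x) := by
    rw [← Finset.Ico_insert_right hmq, Finset.sum_insert Finset.right_notMem_Ico, add_comm]
    refine add_le_add ((Finset.sum_le_sum fun l _ => hyC (i, l)).trans (le_of_eq ?_)) (hys _ hq)
    dsimp only
    rw [Finset.sum_const, nsmul_eq_mul, Nat.card_Ico, hk, Nat.cast_sub hmq,
      Nat.cast_sub (by omega)]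
    push_cast
    ring
  rw [startDemand] at hS
  linarith

/-- The hypothesis `hcrit` treats both halves of feasibility at once: it is vacuous without restarts
and says that task `i` is critical otherwise. -/
theorem completed_deadline (hσ : τ.IsFPSchedule R e σ) (hR : ∀ r ∈ R, 0 ≤ r)
    (he : τ.ValidExec e) (hL : ∀ t, 0 ≤ t → ∃ ρ, LastStart R ρ t)
    (hcrit : ∀ r ∈ R, τ.Critical i) {Λ : ℝ} (hΛ : τ.AnalysisBound i Λ)
    (hsep : ∀ r ∈ R, ∀ r' ∈ R, r < r' → Λ ≤ r' - r ∧
      ∀ k : ℕ, 1 ≤ k → ((k : ℝ) - 1) * τ.T i < Λ → k * τ.T i ≤ r' - r) (q : ℕ) :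
    Completed R e σ (i, q) (τ.deadline (i, q)) := by
  by_contra hJ
  obtain ⟨hΛ0, hΛb, hΛS⟩ := hΛ
  obtain ⟨a, har, hw, hmax⟩ := exists_busyWindow τ R e σ hR (i, q)
  have hlt : τ.release (i, q) < a + Λ := by
    by_contra! hc
    exact release_lt_of_busyDemand_le hσ hR he hL hcrit hΛ0 hΛb
      (fun r hr r' hr' h => (hsep r hr r' hr' h).1) (hw _ (Or.inl hc))
      (hmax _ (by linarith) hc)
  set m := ⌈(a - τ.φ i) / τ.T i⌉₊ with hm
  have hmq : m ≤ q := τ.ceil_le_iff_le_release.2 har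
  have hma : a ≤ τ.release (i, m) := τ.ceil_le_iff_le_release.1 le_rfl
  have hkm : ((q + 1 - m : ℕ) : ℝ) - 1 = q - m := by
    rw [Nat.cast_sub (by omega)]; push_cast; ring
  have hkT : (((q + 1 - m : ℕ) : ℝ) - 1) * τ.T i ≤ τ.release (i, q) - a := by
    rw [hkm]
    simp only [release] at hma ⊢
    linarith
  have hk1 : 1 ≤ q + 1 - m := by omega
  obtain ⟨S, hS0, hS, hSD⟩ := hΛS _ hk1 (by linarith)
  have hQ := τ.Q_nonneg i
  have hf : ¬ Completed R e σ (i, q) (a + (S + τ.Q i)) := fun hc =>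
    hJ (hc.mono (by simp only [deadline]; linarith))
  -- `S + Q ≤ (k - 1) * T + D ≤ k * T`, which is at most the distance between two restarts; so there
  -- is at most one restart before `a + S + Q`.
  have hSsep : ∀ r ∈ R, ∀ r' ∈ R, r < r' → S + τ.Q i ≤ r' - r := fun r hr r' hr' h => by
    have := (hsep r hr r' hr' h).2 _ hk1 (by linarith)
    linarith [τ.D_le_T i]
  have key : ∀ x, S ≤ x → x ≤ S + τ.Q i →
      (∀ j, (⌈x / τ.T j⌉ : ℝ) ≤ (⌊S / τ.T j⌋ : ℝ) + 1) →
      ∃ ρ, ρ ≤ a + x ∧ Epoch R ρ (a + (S + τ.Q i)) ∧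
        τ.C i - τ.Q i + (x - S) ≤ service σ (i, q) ρ (a + x) := by
    intro x h1 h2 h3
    have hxc : ¬ Completed R e σ (i, q) (a + x) := fun hc => hf (hc.mono (by linarith))
    obtain ⟨ρ, o, hE, hoO, ho0, hser⟩ := exists_service_ge_of_startDemand hσ hR he hL hcrit
      (hw _ (Or.inr hxc)) (hS0.trans h1) hxc (fun l hl => τ.ceil_le_iff_le_release.2 hl) hmq rfl
      (fun r hr r' hr' g1 g2 g3 => by have := hSsep r hr r' hr' g2; linarith) hS h3
    refine ⟨ρ, hE.2.2.1, ⟨hE.1, hE.2.1, by linarith [hE.2.2.1], fun r hr hc => ?_⟩, by linarith⟩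
    -- A restart in `[a + x, a + S + Q)` would be the only one in the window. By `a + x` the
    -- overhead would then be unspent, and this slack, at least `C`, would already have completed
    -- the job.
    rcases lt_or_ge r (a + x) with h4 | h4
    · exact hE.2.2.2 r hr ⟨hc.1, h4⟩
    · rw [ho0 fun r' hr' g => ?_, τ.overhead_of_critical (hcrit r hr)] at hser
      · refine hxc (hE.completed ?_)
        linarith [(he (i, q) ρ).2, τ.C_le_WCWE i, τ.Cr_nonneg, τ.Q_le_C i]
      · by_contra! hlt
        have := hSsep r' hr' r hr (hlt.trans_le h4)
        linarith [hc.2]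
  -- Without an ending region the job is complete at `a + S` itself. Otherwise it is strictly inside
  -- the region at some `a + x` just after `a + S` and runs on until `a + S + Q`.
  rcases hQ.eq_or_lt with hQ0 | hQ0
  · obtain ⟨ρ, -, hE, hser⟩ := key S le_rfl (by linarith) fun j => by
      exact_mod_cast Int.ceil_le_floor_add_one _
    rw [← hQ0, add_zero] at hE hf
    refine hf (hE.completed ?_)
    linarith [(he (i, q) ρ).2]
  · obtain ⟨x, hx, hxS⟩ := ((eventually_ceil_le_floor_add_one τ S).and
      (Ioc_mem_nhdsGT (lt_add_of_pos_right S hQ0))).exists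
    obtain ⟨ρ, hρx, hE, hser⟩ := key x hxS.1.le hxS.2 hx
    have hbf : a + x ≤ a + (S + τ.Q i) := by linarith [hxS.2]
    have hm' := hσ.measurable (i, q)
    have hmono := service_mono hm' hρx hbf
    obtain ⟨c, g1, g2, g3, -, g5⟩ := hσ.exists_running_on hR hE
      (by simp only; linarith [hxS.1]) hf
    have hcx : c ≤ a + x := by
      by_contra! hc
      have := service_mono hm' hρx hc.le
      simp only at g3
      linarith [hxS.1]
    have h5 := service_add hm' hρx hbf
    rw [service_eq_sub hbf fun s hs => g5 s ⟨hcx.trans hs.1, hs.2⟩] at h5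
    refine hf (hE.completed ?_)
    linarith [(he (i, q) ρ).2]

end TaskSet

namespace TaskSet

variable {n : ℕ} {τ : TaskSet n}
variable {R : Set ℝ} {e : Fin n × ℕ → ℝ → ℝ} {σ σ' : ℝ → Option (Fin n × ℕ)} {J J' : Fin n × ℕ}
  {ρ ρ' s t u v : ℝ}

/-! ### Causality -/

section Congr

/-- All predicates of the scheduler at time `t` depend only on the schedule strictly before `t`, so
a decision at `t` can be made without circularity. -/
theorem service_congr (h : ∀ s < u, σ' s = σ s) : service σ' J ρ u = service σ J ρ u := by
  have : {s | s ∈ Ico ρ u ∧ σ' s = some J} = {s | s ∈ Ico ρ u ∧ σ s = some J} := by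
    ext s
    exact and_congr_right fun hs => by rw [h s hs.2]
  rw [service, service, this]

theorem completed_congr (h : ∀ s < t, σ' s = σ s) :
    Completed R e σ' J t ↔ Completed R e σ J t := by
  constructor
  · rintro ⟨ρ, u, h1, h2, h3, h4, h5, h6⟩
    rw [service_congr fun s hs => h s (hs.trans_le h4)] at h6
    exact ⟨ρ, u, h1, h2, h3, h4, h5, h6⟩
  · rintro ⟨ρ, u, h1, h2, h3, h4, h5, h6⟩
    rw [← service_congr fun s hs => h s (hs.trans_le h4)] at h6
    exact ⟨ρ, u, h1, h2, h3, h4, h5, h6⟩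

theorem pending_congr (h : ∀ s < t, σ' s = σ s) :
    τ.Pending R e σ' J t ↔ τ.Pending R e σ J t := by
  rw [Pending, Pending, completed_congr h]

theorem nonPreemptive_congr (h : ∀ s < t, σ' s = σ s) :
    τ.NonPreemptive R e σ' J t ↔ τ.NonPreemptive R e σ J t := by
  simp only [NonPreemptive, pending_congr h, service_congr h]

theorem eligible_congr (h : ∀ s < t, σ' s = σ s) :
    τ.Eligible R e σ' J t ↔ τ.Eligible R e σ J t := by
  simp only [Eligible, pending_congr h, nonPreemptive_congr h]

end Congr

/-! ### Existence of schedules -/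

/-- A set that is a right neighbourhood of each of its points is measurable, so measurability need
not be carried through the construction. -/
theorem measurableSet_eq_some
    (h : ∀ t, σ t = some J → ∃ ε > 0, ∀ s ∈ Ico t (t + ε), σ s = σ t) :
    MeasurableSet {t | σ t = some J} := by
  refine MeasurableSet.of_mem_nhdsGT fun t ht => ?_
  obtain ⟨ε, hε, hc⟩ := h t ht
  filter_upwards [Ioo_mem_nhdsGT (lt_add_of_pos_right t hε)] with s hs
  exact (hc s (Ioo_subset_Ico_self hs)).trans ht

/-- A schedule produced by the scheduler up to the time `a`. -/
structure IsFPScheduleOn (τ : TaskSet n) (R : Set ℝ) (e : Fin n × ℕ → ℝ → ℝ) (a : EReal)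
    (σ : ℝ → Option (Fin n × ℕ)) : Prop where
  eq_none : ∀ t : ℝ, t < 0 ∨ a ≤ t → σ t = none
  right_constant : ∀ t : ℝ, 0 ≤ t → (t : EReal) < a → ∃ ε > 0, ∀ s ∈ Ico t (t + ε), σ s = σ t
  rebooting : ∀ t : ℝ, 0 ≤ t → (t : EReal) < a → τ.Rebooting R t → σ t = none
  work_conserving : ∀ t : ℝ, 0 ≤ t → (t : EReal) < a → ¬ τ.Rebooting R t →
    (∃ J, τ.Pending R e σ J t) → σ t ≠ none
  eligible : ∀ t : ℝ, 0 ≤ t → (t : EReal) < a → ∀ J, σ t = some J → τ.Eligible R e σ J t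

namespace IsFPScheduleOn

variable {a : EReal}

/-- The conditions at `t` involve only the past and a short time to the right; this glues a chain of
partial schedules. -/
theorem of_locally (h0 : ∀ t : ℝ, t < 0 ∨ a ≤ t → σ' t = none)
    (h : ∀ t : ℝ, 0 ≤ t → (t : EReal) < a → ∃ (b : EReal) (σ : ℝ → Option (Fin n × ℕ)),
      (t : EReal) < b ∧ (∀ s : ℝ, (s : EReal) < b → σ' s = σ s) ∧ τ.IsFPScheduleOn R e b σ) :
    τ.IsFPScheduleOn R e a σ' := by
  have hpast : ∀ {t : ℝ} {b : EReal} {σ : ℝ → Option (Fin n × ℕ)}, (t : EReal) < b →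
      (∀ s : ℝ, (s : EReal) < b → σ' s = σ s) → ∀ s < t, σ' s = σ s :=
    fun htb hag s hs => hag s ((EReal.coe_lt_coe_iff.2 hs).trans htb)
  refine ⟨h0, fun t ht hta => ?_, fun t ht hta => ?_, fun t ht hta => ?_, fun t ht hta => ?_⟩ <;>
    obtain ⟨b, σ, htb, hag, hσ⟩ := h t ht hta
  · obtain ⟨ε, hε, hc⟩ := hσ.right_constant t ht htb
    obtain ⟨u, htu, hub⟩ := EReal.lt_iff_exists_real_btwn.1 htb
    have htu := EReal.coe_lt_coe_iff.1 htu
    refine ⟨min ε (u - t), lt_min hε (sub_pos.2 htu), fun s hs => ?_⟩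
    have hs1 : s < t + ε := hs.2.trans_le (by linarith [min_le_left ε (u - t)])
    have hs2 : s < u := hs.2.trans_le (by linarith [min_le_right ε (u - t)])
    rw [hag t htb, hag s ((EReal.coe_lt_coe_iff.2 hs2).trans hub), hc s ⟨hs.1, hs1⟩]
  · rw [hag t htb]
    exact hσ.rebooting t ht htb
  · rw [hag t htb]
    simp only [pending_congr (hpast htb hag)]
    exact hσ.work_conserving t ht htb
  · rw [hag t htb]
    intro J hJ
    rw [eligible_congr (hpast htb hag)]
    exact hσ.eligible t ht htb J hJ

theorem exists_eligible {α : ℝ} (hσ : τ.IsFPScheduleOn R e α σ) (hR : ∀ r ∈ R, 0 ≤ r)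
    (hp : ∃ J, τ.Pending R e σ J α) : ∃ J, τ.Eligible R e σ J α := by
  by_cases hnp : ∃ J, τ.NonPreemptive R e σ J α
  · obtain ⟨J, hJ⟩ := hnp
    refine ⟨J, hJ.1, fun k hk hpk => ?_, Or.inl hJ⟩
    obtain ⟨-, ρ, hρ, hs⟩ := hJ
    -- A non-preemptive job has already run, and when it ran all earlier jobs of its task were
    -- complete.
    obtain ⟨s, hs, hsJ⟩ := exists_of_service_pos
      ((sub_nonneg.2 (τ.Q_le_C J.1)).trans_lt hs)
    have hel := hσ.eligible s ((hρ.nonneg hR).trans hs.1) (EReal.coe_lt_coe_iff.2 hs.2) J hsJ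
    exact hel.2.1 k hk ⟨(τ.release_mono J.1 hk.le).trans hel.1.1, fun hc => hpk.2 (hc.mono hs.2.le)⟩
  · push Not at hnp
    obtain ⟨i, ⟨k, hk⟩, hi⟩ := wellFounded_lt.has_min {i : Fin n | ∃ k, τ.Pending R e σ (i, k) α}
      (by obtain ⟨⟨i, k⟩, hJ⟩ := hp; exact ⟨i, k, hJ⟩)
    classical
    have hex : ∃ k, τ.Pending R e σ (i, k) α := ⟨k, hk⟩
    exact ⟨(i, Nat.find hex), Nat.find_spec hex, fun l hl => Nat.find_min hex hl,
      Or.inr ⟨hnp, fun J' hJ' => not_lt.1 (hi J'.1 ⟨J'.2, hJ'⟩)⟩⟩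

end IsFPScheduleOn

open Filter Topology in
theorem eventually_no_release (τ : TaskSet n) (α : ℝ) :
    ∀ᶠ s in 𝓝[>] α, ∀ J : Fin n × ℕ, ¬ (α < τ.release J ∧ τ.release J ≤ s) := by
  have h : ∀ᶠ s in 𝓝[>] α, ∀ i : Fin n, ∀ k : ℕ,
      ¬ (α < τ.release (i, k) ∧ τ.release (i, k) ≤ s) := by
    refine eventually_all.2 fun i => ?_
    have h1 : ∀ᶠ s in 𝓝[>] α, ∀ k ∈ τ.releasedIn i 0 (α + 1),
        ¬ (α < τ.release (i, k) ∧ τ.release (i, k) ≤ s) := by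
      refine (Finset.eventually_all _).2 fun k _ => ?_
      rcases le_or_gt (τ.release (i, k)) α with hle | hgt
      · exact Eventually.of_forall fun s hc => absurd hc.1 (not_lt.2 hle)
      · filter_upwards [Ioo_mem_nhdsGT hgt] with s hs hc
        exact absurd hc.2 (not_le.2 hs.2)
    filter_upwards [h1, Ioo_mem_nhdsGT (lt_add_one α)] with s hs hs1 k hc
    exact hs k (τ.mem_releasedIn.2 ⟨τ.release_nonneg _, hc.2.trans_lt hs1.2⟩) hc
  filter_upwards [h] with s hs J
  exact hs J.1 J.2

open Filter Topology in
theorem eventually_no_restart {δ : ℝ} (hδ : 0 < δ)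
    (hsep : ∀ r ∈ R, ∀ r' ∈ R, r < r' → δ ≤ r' - r) (α : ℝ) :
    ∀ᶠ s in 𝓝[>] α, ∀ r ∈ R, ¬ (α < r ∧ r ≤ s) := by
  by_cases hex : ∃ r ∈ R, α < r ∧ r < α + δ
  · obtain ⟨r₀, hr₀, h1, h2⟩ := hex
    filter_upwards [Ioo_mem_nhdsGT h1] with s hs r hr hc
    have := hsep r hr r₀ hr₀ (hc.2.trans_lt hs.2)
    linarith
  · push Not at hex
    filter_upwards [Ioo_mem_nhdsGT (lt_add_of_pos_right α hδ)] with s hs r hr hc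
    exact absurd (hex r hr hc.1) (not_le.2 (hc.2.trans_lt hs.2))

open Filter Topology in
/-- A schedule up to the time `α` can be continued. -/
theorem IsFPScheduleOn.exists_extension {α : ℝ} (hσ : τ.IsFPScheduleOn R e α σ)
    (hR : ∀ r ∈ R, 0 ≤ r) {δ : ℝ} (hδ : 0 < δ)
    (hsep : ∀ r ∈ R, ∀ r' ∈ R, r < r' → δ ≤ r' - r) (hα : 0 ≤ α) :
    ∃ (β : ℝ) (σ' : ℝ → Option (Fin n × ℕ)), α < β ∧ (∀ s < α, σ' s = σ s) ∧
      τ.IsFPScheduleOn R e β σ' := by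
  obtain ⟨ρ, hρ⟩ := exists_lastStart hδ hsep hα
  have hρα := hρ.2.1
  obtain ⟨d, hd1, hd2, hd3⟩ : ∃ d : Option (Fin n × ℕ), (τ.Rebooting R α → d = none) ∧
      (¬ τ.Rebooting R α → (∃ J, τ.Pending R e σ J α) → d ≠ none) ∧
      (∀ J, d = some J → τ.Eligible R e σ J α) := by
    by_cases hr : τ.Rebooting R α
    · exact ⟨none, fun _ => rfl, fun h => absurd hr h, by simp⟩
    by_cases hp : ∃ J, τ.Pending R e σ J α
    · obtain ⟨J, hJ⟩ := hσ.exists_eligible hR hp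
      refine ⟨some J, fun h => absurd h hr, by simp, fun J' h => ?_⟩
      rwa [← Option.some.inj h]
    · exact ⟨none, fun _ => rfl, fun _ h => absurd h hp, by simp⟩
  have h3 : ∀ᶠ s in 𝓝[>] α, τ.Rebooting R α → τ.Rebooting R s := by
    by_cases hr : τ.Rebooting R α
    · obtain ⟨r, hr, h1, h2⟩ := hr
      filter_upwards [Ioo_mem_nhdsGT h2] with s hs _
      exact ⟨r, hr, h1.trans hs.1.le, hs.2⟩
    · exact Eventually.of_forall fun s h => absurd h hr
  have h4 : ∀ᶠ s in 𝓝[>] α, ∀ J, d = some J → service σ J ρ α + (s - α) < e J ρ := by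
    rcases d with _ | J
    · exact Eventually.of_forall fun s J h => absurd h (by simp)
    · have hlt : service σ J ρ α < e J ρ := by
        by_contra! hc
        exact (hd3 J rfl).1.2 ((hρ.epoch hR).completed hc)
      filter_upwards [Ioo_mem_nhdsGT (show α < α + (e J ρ - service σ J ρ α) by linarith)]
        with s hs J' hJ'
      rw [← Option.some.inj hJ']
      linarith [hs.2]
  -- The decision `d` is kept on `[α, β)`, with `β` before the next release, the next restart, the
  -- end of a current reboot and the completion of the chosen job.
  obtain ⟨β, ⟨⟨⟨⟨hb1, hb2⟩, hb3⟩, hb4⟩, hαβ⟩⟩ :=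
    ((((eventually_no_release τ α).and (eventually_no_restart hδ hsep α)).and h3).and h4).and
      self_mem_nhdsWithin |>.exists
  have hαβ : α < β := hαβ
  classical
  set σ' : ℝ → Option (Fin n × ℕ) := fun s => if s < α then σ s else if s < β then d else none
    with hσ'
  have hlow : ∀ s < α, σ' s = σ s := fun s hs => if_pos hs
  have hmid : ∀ s, α ≤ s → s < β → σ' s = d := fun s h1 h2 => by
    rw [hσ']; simp only [if_neg (not_lt.2 h1), if_pos h2]
  have hnone : ∀ t : ℝ, t < 0 ∨ (β : EReal) ≤ t → σ' t = none := by
    rintro t (ht | ht)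
    · rw [hlow t (ht.trans_le hα)]
      exact hσ.eq_none t (Or.inl ht)
    · have ht := EReal.coe_le_coe_iff.1 ht
      rw [hσ']
      simp only [if_neg (not_lt.2 (hαβ.le.trans ht)), if_neg (not_lt.2 ht)]
  have hrc : ∀ t, 0 ≤ t → t < β → ∃ ε > 0, ∀ s ∈ Ico t (t + ε), σ' s = σ' t := by
    intro t ht htβ
    rcases lt_or_ge t α with h | h
    · obtain ⟨ε, hε, hc⟩ := hσ.right_constant t ht (EReal.coe_lt_coe_iff.2 h)
      refine ⟨min ε (α - t), lt_min hε (sub_pos.2 h), fun s hs => ?_⟩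
      have hs1 : s < t + ε := hs.2.trans_le (by linarith [min_le_left ε (α - t)])
      have hs2 : s < α := hs.2.trans_le (by linarith [min_le_right ε (α - t)])
      rw [hlow t h, hlow s hs2, hc s ⟨hs.1, hs1⟩]
    · refine ⟨β - t, sub_pos.2 htβ, fun s hs => ?_⟩
      rw [hmid t h htβ, hmid s (h.trans hs.1) (by linarith [hs.2])]
  have hmeas : ∀ J, MeasurableSet {t | σ' t = some J} := fun J => by
    refine measurableSet_eq_some fun t ht => hrc t ?_ ?_ <;> by_contra! hc
    · rw [hnone t (Or.inl hc)] at ht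
      exact absurd ht (by simp)
    · rw [hnone t (Or.inr (EReal.coe_le_coe_iff.2 hc))] at ht
      exact absurd ht (by simp)
  have hpast : ∀ t ≤ α, ∀ s < t, σ' s = σ s := fun t ht s hs => hlow s (hs.trans_le ht)
  simp only [← eligible_congr (hpast α le_rfl), ← pending_congr (hpast α le_rfl)] at hd2 hd3
  simp only [← service_congr (hpast α le_rfl)] at hb4
  have hreb : ∀ s, α ≤ s → s < β → (τ.Rebooting R s ↔ τ.Rebooting R α) := by
    intro s h1 h2
    constructor
    · rintro ⟨r, hr, g1, g2⟩
      exact ⟨r, hr, not_lt.1 fun hc => hb2 r hr ⟨hc, g1.trans h2.le⟩, h1.trans_lt g2⟩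
    · intro h
      obtain ⟨r, hr, g1, g2⟩ := hb3 h
      exact ⟨r, hr, not_lt.1 fun hc => hb2 r hr ⟨h1.trans_lt hc, g1⟩, h2.trans g2⟩
  have hpend : ∀ s, α ≤ s → s < β → ∀ J, τ.Pending R e σ' J s → τ.Pending R e σ' J α :=
    fun s h1 h2 J h => ⟨not_lt.1 fun hc => hb1 J ⟨hc, h.1.trans h2.le⟩,
      fun hc => h.2 (hc.mono h1)⟩
  have hlast : ∀ s, α ≤ s → s < β → LastStart R ρ s := fun s h1 h2 =>
    ⟨hρ.1, hρα.trans h1, fun r hr hrs => hρ.2.2 r hr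
      (not_lt.1 fun hc => hb2 r hr ⟨hc, hrs.trans h2.le⟩)⟩
  have hnc : ∀ J, d = some J → ∀ s, α ≤ s → s < β → ¬ Completed R e σ' J s := by
    rintro J hJ s h1 h2 ⟨ρ', u, g1, g2, g3, g4, g5, g6⟩
    rcases le_or_gt u α with hu | hu
    · exact (hd3 J hJ).1.2 ⟨ρ', u, g1, g2, g3, hu, g5, g6⟩
    -- `Completed` permits a restart at `u` itself; here it is excluded because no restart lies in
    -- `(α, β]`.
    have hρ' : LastStart R ρ' u := by
      refine ⟨g1, g3, fun r hr hru => ?_⟩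
      rcases hru.eq_or_lt with rfl | hlt
      · exact absurd ⟨hu, g4.trans h2.le⟩ (hb2 r hr)
      · exact not_lt.1 fun hc => g5 r hr ⟨hc, hlt⟩
    rw [hρ'.unique hR (hlast u hu.le (g4.trans_lt h2))] at g6
    have := service_le_add (hmeas J) hρα hu.le
    linarith [hb4 J hJ]
  refine ⟨β, σ', hαβ, hlow, hnone, fun t ht htβ => hrc t ht (EReal.coe_lt_coe_iff.1 htβ), ?_, ?_,
    ?_⟩ <;> intro t ht htβ <;> replace htβ := EReal.coe_lt_coe_iff.1 htβ <;>
    rcases lt_or_ge t α with h | h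
  · rw [hlow t h]
    exact hσ.rebooting t ht (EReal.coe_lt_coe_iff.2 h)
  · rw [hmid t h htβ, hreb t h htβ]
    exact hd1
  · rw [hlow t h]
    simp only [pending_congr (hpast t h.le)]
    exact hσ.work_conserving t ht (EReal.coe_lt_coe_iff.2 h)
  · rw [hmid t h htβ, hreb t h htβ]
    rintro hr ⟨J, hJ⟩
    exact hd2 hr ⟨J, hpend t h htβ J hJ⟩
  · rw [hlow t h]
    simp only [eligible_congr (hpast t h.le)]
    exact hσ.eligible t ht (EReal.coe_lt_coe_iff.2 h)
  · rw [hmid t h htβ]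
    intro J hJ
    obtain ⟨e1, e2, e3⟩ := hd3 J hJ
    have hpt : τ.Pending R e σ' J t := ⟨e1.1.trans h, hnc J hJ t h htβ⟩
    refine ⟨hpt, fun k hk hc => e2 k hk (hpend t h htβ _ hc), ?_⟩
    by_cases hnp : τ.NonPreemptive R e σ' J t
    · exact Or.inl hnp
    have hnpα : ¬ τ.NonPreemptive R e σ' J α := by
      rintro ⟨-, ρ', hρ', g⟩
      rw [hρ'.unique hR hρ] at g
      exact hnp ⟨hpt, ρ, hlast t h htβ, g.trans_le (service_mono (hmeas J) hρα h)⟩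
    obtain ⟨e4, e5⟩ := e3.resolve_left hnpα
    refine Or.inr ⟨fun J' hJ' => ?_, fun J' hJ' => e5 J' (hpend t h htβ J' hJ')⟩
    by_cases hJJ : J' = J
    · rw [hJJ] at hJ'
      exact hnp hJ'
    obtain ⟨hp', ρ', hρ', g⟩ := hJ'
    rw [hρ'.unique hR (hlast t h htβ), service_add (hmeas J') hρα h,
      service_eq_zero (ρ := α), add_zero] at g
    · exact e4 J' ⟨hpend t h htβ J' hp', ρ, hρ, g⟩
    · intro s hs hc
      rw [hmid s hs.1 (hs.2.trans htβ), hJ] at hc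
      exact hJJ (Option.some.inj hc).symm

/-- The scheduler produces a schedule whenever the restarts are separated. -/
theorem exists_isFPSchedule (τ : TaskSet n) (e : Fin n × ℕ → ℝ → ℝ) (hR : ∀ r ∈ R, 0 ≤ r)
    {δ : ℝ} (hδ : 0 < δ) (hsep : ∀ r ∈ R, ∀ r' ∈ R, r < r' → δ ≤ r' - r) :
    ∃ σ, τ.IsFPSchedule R e σ := by
  let X := {p : EReal × (ℝ → Option (Fin n × ℕ)) // τ.IsFPScheduleOn R e p.1 p.2}
  let le : X → X → Prop := fun p q => p.1.1 ≤ q.1.1 ∧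
    ∀ s : ℝ, (s : EReal) < p.1.1 → q.1.2 s = p.1.2 s
  -- Zorn's lemma for partial schedules ordered by extension. Horizons in `EReal` provide suprema of
  -- chains and the goal `⊤`.
  obtain ⟨⟨⟨a, σ⟩, hσ⟩, hmax⟩ : ∃ m : X, ∀ x, le m x → le x m := by
    refine exists_maximal_of_chains_bounded (fun c hc => ?_)
      (fun {p q r} h1 h2 => ⟨h1.1.trans h2.1, fun s hs => ?_⟩)
    · classical
      let σ : ℝ → Option (Fin n × ℕ) := fun s =>
        if h : ∃ p ∈ c, (s : EReal) < p.1.1 then h.choose.1.2 s else none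
      have hag : ∀ p ∈ c, ∀ s : ℝ, (s : EReal) < p.1.1 → σ s = p.1.2 s := by
        intro p hp s hs
        have hex : ∃ p ∈ c, (s : EReal) < p.1.1 := ⟨p, hp, hs⟩
        have h1 : σ s = hex.choose.1.2 s := dif_pos hex
        rw [h1]
        obtain ⟨hq, hsq⟩ := hex.choose_spec
        by_cases heq : hex.choose = p
        · rw [heq]
        · rcases hc hq hp heq with h | h
          · exact (h.2 s hsq).symm
          · exact h.2 s hs
      refine ⟨⟨(sSup ((fun p : X => p.1.1) '' c), σ), IsFPScheduleOn.of_locally ?_ ?_⟩,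
        fun p hp => ⟨le_sSup ⟨p, hp, rfl⟩, fun s hs => hag p hp s hs⟩⟩
      · intro t ht
        by_cases hex : ∃ p ∈ c, (t : EReal) < p.1.1
        · obtain ⟨p, hp, htp⟩ := hex
          rcases ht with ht | ht
          · exact (hag p hp t htp).trans (p.2.eq_none t (Or.inl ht))
          · exact absurd (htp.trans_le (le_sSup (mem_image_of_mem (fun p : X => p.1.1) hp))) (not_lt.2 ht)
        · exact dif_neg hex
      · intro t _ ht
        obtain ⟨_, ⟨p, hp, rfl⟩, htp⟩ := lt_sSup_iff.1 ht
        exact ⟨p.1.1, p.1.2, htp, hag p hp, p.2⟩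
    · rw [h2.2 s (hs.trans_le h1.1), h1.2 s hs]
  have htop : a = ⊤ := by
    by_contra hne
    -- Extension requires a nonnegative horizon; a negative one is beaten by the empty schedule up
    -- to `0`.
    rcases lt_or_ge a 0 with h0 | h0
    · have hv : τ.IsFPScheduleOn R e 0 (fun _ => none) :=
        IsFPScheduleOn.of_locally (fun _ _ => rfl) fun t ht ht0 =>
          absurd (EReal.coe_nonneg.2 ht) (not_le.2 ht0)
      refine absurd (hmax ⟨(0, fun _ => none), hv⟩ ⟨h0.le, fun s hs => ?_⟩).1 (not_le.2 h0)
      exact (hσ.eq_none s (Or.inl (EReal.coe_neg'.1 (lt_trans hs h0)))).symm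
    · obtain ⟨α, rfl⟩ : ∃ α : ℝ, a = α :=
        ⟨a.toReal, (EReal.coe_toReal hne (ne_bot_of_le_ne_bot (by simp) h0)).symm⟩
      obtain ⟨β, σ', hαβ, hag, hv⟩ := hσ.exists_extension hR hδ hsep (EReal.coe_nonneg.1 h0)
      have := (hmax ⟨(β, σ'), hv⟩ ⟨EReal.coe_le_coe_iff.2 hαβ.le,
        fun s hs => hag s (EReal.coe_lt_coe_iff.1 hs)⟩).1
      exact absurd (EReal.coe_le_coe_iff.1 this) (not_le.2 hαβ)
  subst htop
  have hlt : ∀ t : ℝ, (t : EReal) < ⊤ := EReal.coe_lt_top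
  refine ⟨σ, fun J => measurableSet_eq_some fun t ht => hσ.right_constant t ?_ (hlt t),
    fun t ht => hσ.right_constant t ht (hlt t), fun t ht => hσ.rebooting t ht (hlt t),
    fun t ht => hσ.work_conserving t ht (hlt t), fun t ht => hσ.eligible t ht (hlt t)⟩
  by_contra! hc
  exact absurd (ht.symm.trans (hσ.eq_none t (Or.inl hc))) (by simp)

end TaskSet

/-! ### Combination of schedule existence and the deadline argument. -/

theorem mainTheorem3 {n : ℕ} (τ : TaskSet n) (hTr : τ.RestartsAreRare) (r : Fin n → ℝ)
    (hr : ∀ i, τ.IsResponseTime i (r i)) (hD : ∀ i, r i ≤ τ.D i) :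
    τ.RBRFeasible := by
  have hA : ∀ i, ∃ L, τ.AnalysisBound i L := fun i => (hr i).exists_analysisBound τ (hD i)
  constructor
  · rintro R e ⟨hR, hsep⟩ he
    obtain ⟨δ, hδ, hsepδ, hcore⟩ : ∃ δ > 0, (∀ r ∈ R, ∀ r' ∈ R, r < r' → δ ≤ r' - r) ∧
        ∀ i, τ.Critical i → ∃ Λ, τ.AnalysisBound i Λ ∧
          ∀ r ∈ R, ∀ r' ∈ R, r < r' → Λ ≤ r' - r ∧
            ∀ k : ℕ, 1 ≤ k → ((k : ℝ) - 1) * τ.T i < Λ → k * τ.T i ≤ r' - r := by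
      rcases hTr with htop | ⟨H, hH, hmul, hHT⟩
      · have hno : ∀ r ∈ R, ∀ r' ∈ R, ¬ r < r' := fun r hr r' hr' h => by
          have := hsep r hr r' hr' h
          rw [htop] at this
          exact absurd this (not_le.2 (EReal.coe_lt_top _))
        refine ⟨1, one_pos, fun r hr r' hr' h => absurd h (hno r hr r' hr'), fun i _ => ?_⟩
        obtain ⟨L, hL⟩ := hA i
        exact ⟨L, hL, fun r hr r' hr' h => absurd h (hno r hr r' hr')⟩
      · have hgap : ∀ r ∈ R, ∀ r' ∈ R, r < r' → H ≤ r' - r := fun r hr r' hr' h =>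
          EReal.coe_le_coe_iff.1 (hHT.le.trans (hsep r hr r' hr' h))
        refine ⟨H, hH, hgap, fun i hi => ?_⟩
        obtain ⟨Λ, hΛH, hΛ⟩ := τ.exists_analysisBound_le hA i hH
          fun j hj => hmul j (lt_of_le_of_lt (Fin.le_def.1 hj) hi)
        refine ⟨Λ, hΛ, fun r hr r' hr' h => ⟨hΛH.trans (hgap r hr r' hr' h), fun k _ hk => ?_⟩⟩
        refine le_trans ?_ (hgap r hr r' hr' h)
        obtain ⟨m, rfl⟩ := hmul i hi
        -- Since `H` is the multiple `m * T` of the period, `(k - 1) * T < Λ ≤ H` already forces `k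
        -- * T ≤ H`.
        have h1 : (k : ℝ) - 1 < m := lt_of_mul_lt_mul_right (hk.trans_le hΛH) (τ.T_pos i).le
        have h2 : k ≤ m := by
          have : (k : ℝ) < (m + 1 : ℕ) := by push_cast; linarith
          have := Nat.cast_lt.1 this
          omega
        exact mul_le_mul_of_nonneg_right (by exact_mod_cast h2) (τ.T_pos i).le
    refine ⟨τ.exists_isFPSchedule e hR hδ hsepδ, fun σ hσ i hi k => ?_⟩
    obtain ⟨Λ, hΛ, hΛs⟩ := hcore i hi
    exact TaskSet.completed_deadline hσ hR he
      (fun t ht => TaskSet.exists_lastStart hδ hsepδ ht) (fun _ _ => hi) hΛ hΛs k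
  · intro e he
    have hR : ∀ r ∈ (∅ : Set ℝ), (0 : ℝ) ≤ r := by simp
    have hs : ∀ r ∈ (∅ : Set ℝ), ∀ r' ∈ (∅ : Set ℝ), r < r' → (1 : ℝ) ≤ r' - r := by simp
    refine ⟨τ.exists_isFPSchedule e hR one_pos hs, fun σ hσ i _ k => ?_⟩
    obtain ⟨L, hL⟩ := hA i
    exact TaskSet.completed_deadline hσ hR he
      (fun t ht => TaskSet.exists_lastStart one_pos hs ht) (by simp) hL (by simp) k
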